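/- A graph is a finite CW complex of dimension at most $1$ (loops and multiple edges allowed). The valence of a vertex $v$ is the number of connected components of $U\setminus\{v\}$ for a sufficiently small connected open neighbourhood $U$ of $v$; $v$ is essential if its valence is at least $3$, and $m(\Gamma)$ denotes the number of essential vertices of $\Gamma$. For $k\geq 0$ let $B_k(\Gamma)=F_k(\Gamma)/\Sigma_k$ be the unordered configuration space, the quotient of $F_k(\Gamma)=\{(x_1,\ldots,x_k)\in\Gamma^k : x_i\neq x_j \text{ if } i\neq j\}$ by permutation of coordinates. Let $\mathrm{cat}(X)$ be the reduced Lusternik--Schnirelmann category of a space $X$, the least $n\geq 0$ such that $X$ has an open cover by at most $n+1$ sets whose inclusions into $X$ are each homotopic to a constant map ($\infty$ if there is no such $n$; in particular $\mathrm{cat}(\mathrm{pt})=\mathrm{cat}(\varnothing)=0$). Theorem. For any connected graph $\Gamma$ that is not homeomorphic to a circle, and any $k\geq 0$, $$\mathrm{cat}(B_k(\Gamma))\leq m(\Gamma).$$ -/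

import Mathlib

namespace GraphConfig

/-- The ordered configuration space `F_k(X)` of `k` pairwise distinct labelled points of `X`,
with the subspace topology of the product `X ^ k`. -/
abbrev OrderedConf (k : ℕ) (X : Type*) : Type _ :=
  {x : Fin k → X // Function.Injective x}

/-- Two ordered configurations are equivalent if they differ by a permutation of the labels. -/
def confSetoid (k : ℕ) (X : Type*) : Setoid (OrderedConf k X) where
  r x y := ∃ σ : Equiv.Perm (Fin k), ∀ i, y.1 i = x.1 (σ i)
  iseqv :=
    { refl := fun _ => ⟨1, fun _ => rfl⟩
      symm := by
        rintro x y ⟨σ, h⟩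
        exact ⟨σ.symm, fun i => by simp [h]⟩
      trans := by
        rintro x y z ⟨σ, h⟩ ⟨τ, h'⟩
        exact ⟨σ * τ, fun i => by simp [h, h']⟩ }

/-- The unordered configuration space `B_k(X) = F_k(X) / Σ_k`, with the quotient topology. -/
abbrev UnorderedConf (k : ℕ) (X : Type*) : Type _ :=
  Quotient (confSetoid k X)

/-- `X` has an open cover by at most `n + 1` sets, each of whose inclusions into `X` is
homotopic to a constant map. (If `X` is empty, the empty cover qualifies.) -/
def HasCategoricalCover (X : Type*) [TopologicalSpace X] (n : ℕ) : Prop :=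
  ∃ 𝒰 : Set (Set X), 𝒰.encard ≤ n + 1 ∧ ⋃₀ 𝒰 = Set.univ ∧
    ∀ U ∈ 𝒰, IsOpen U ∧
      (⟨Subtype.val, continuous_subtype_val⟩ : C(U, X)).Nullhomotopic

/-- The (reduced) Lusternik--Schnirelmann category: the least `n` such that `X` has a categorical
open cover with at most `n + 1` members, and `⊤` if there is no such `n`. A one-point space has
category `0`. -/
noncomputable def lsCat (X : Type*) [TopologicalSpace X] : ℕ∞ :=
  ⨅ (n : ℕ) (_ : HasCategoricalCover X n), (n : ℕ∞)

/-- The point `x` has valence `d`: for every sufficiently small connected open neighbourhood `U`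
of `x`, the complement `U \ {x}` has exactly `d` connected components. -/
def HasValence {X : Type*} [TopologicalSpace X] (x : X) (d : ℕ) : Prop :=
  ∃ N ∈ nhds x, ∀ U ⊆ N, IsOpen U → IsConnected U → x ∈ U →
    ENat.card (ConnectedComponents ↥(U \ {x})) = d

/-- The essential vertices of a CW complex structure on `X`: the `0`-cells of valence at least
three. -/
def essentialVertices (X : Type*) [TopologicalSpace X]
    [Topology.CWComplex (Set.univ : Set X)] : Set X :=
  {v | (∃ e : Topology.RelCWComplex.cell (Set.univ : Set X) 0,
      v ∈ Topology.RelCWComplex.openCell 0 e) ∧ ∃ d : ℕ, 3 ≤ d ∧ HasValence v d}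

end GraphConfig

open Set Topology unitInterval

namespace GraphConfig

/-! Let `V` be the vertex set of a model of the graph. Measure distances to a vertex `v` inside its
star, truncated to `1` outside, and let `ratio v` be the smallest distance from a point of the
configuration to `v` divided by the second smallest. Two distinct points cannot both sit at `v`, so
the denominator is positive and the ratio is continuous on `B_k`. If it is positive, `v` is
unoccupied; if it is less than `1`, a single point in the star of `v` is strictly closest to `v`.

Fix `O ⊆ V` and require a ratio below `1` at the vertices of `O` and a positive one at the others.
The closest points can be pushed into the vertices of `O` without collisions. All other points lie
on open arcs, where their linear order is locally constant, so linear interpolation slides them to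
standard positions. Hence the configurations of one combinatorial type contract inside `F_k`
(`isCategorical_sameType`). A relabelling that preserves the type of a configuration is trivial
(`perm_eq_self_of_sameType`), so each type embeds in `B_k`. The locus belonging to `O` is a disjoint
union of such images, and it is categorical because `B_k` is path-connected
(`isCategorical_nearSet`).

There are `2 ^ |V|` such loci, but only `|V| + 1` sets are needed: the loci can be shrunk so that
those with the same number of indices are disjoint, while still covering (`lsCat_le_card`). This
bounds the category by `|V|` for every model.

It remains to choose a model without superfluous vertices (`exists_model_three_le`). A vertex with
no half-edge forces the graph to be a point, and two half-edges of one loop, with no others, force a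
circle. A vertex with one half-edge can be forgotten, and two half-edges of different edges can be
merged. At every surviving vertex the valence is the number of half-edges (`hasValence`), which is
at least three, so the vertex is essential. -/

/-! ### Categorical open sets -/

section Categorical

variable {X Y : Type*} [TopologicalSpace X] [TopologicalSpace Y]

/-- An open subset of `X` whose inclusion into `X` is homotopic to a constant map. -/
def IsCategorical (U : Set X) : Prop :=
  IsOpen U ∧ (⟨Subtype.val, continuous_subtype_val⟩ : C(U, X)).Nullhomotopic

theorem IsCategorical.mono {U W : Set X} (hU : IsCategorical U) (hWU : W ⊆ U) (hW : IsOpen W) :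
    IsCategorical W :=
  ⟨hW, hU.2.comp_left ⟨Set.inclusion hWU, continuous_inclusion hWU⟩⟩

theorem IsCategorical.homotopic_const (hX : ∀ x y : X, Joined x y) {U : Set X}
    (hU : IsCategorical U) (x₀ : X) :
    (⟨Subtype.val, continuous_subtype_val⟩ : C(U, X)).Homotopic (ContinuousMap.const U x₀) := by
  obtain ⟨y, hy⟩ := hU.2
  obtain ⟨p⟩ := hX y x₀
  refine hy.trans ⟨⟨⟨fun q => p q.1, by fun_prop⟩, ?_, ?_⟩⟩ <;> simp

/-- In a path-connected space, a disjoint union of categorical sets is categorical. -/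
theorem IsCategorical.sUnion [Nonempty X] (hX : ∀ x y : X, Joined x y) {𝒲 : Set (Set X)}
    (hd : 𝒲.PairwiseDisjoint id) (h𝒲 : ∀ W ∈ 𝒲, IsCategorical W) : IsCategorical (⋃₀ 𝒲) := by
  refine ⟨isOpen_sUnion fun W hW => (h𝒲 W hW).1, ?_⟩
  obtain ⟨x₀⟩ := ‹Nonempty X›
  refine ⟨x₀, ?_⟩
  have H : ∀ W : 𝒲, Nonempty ((⟨Subtype.val, continuous_subtype_val⟩ : C(W.1, X)).Homotopy
      (ContinuousMap.const W.1 x₀)) := fun W => (h𝒲 W W.2).homotopic_const hX x₀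
  replace H := fun W => (H W).some
  let S : 𝒲 → Set (I × ↥(⋃₀ 𝒲)) := fun W => {p | p.2.1 ∈ W.1}
  let φ : ∀ W : 𝒲, C(S W, X) := fun W =>
    (H W).toContinuousMap.comp ⟨fun p => (p.1.1, ⟨p.1.2.1, p.2⟩), by fun_prop⟩
  have hφ : ∀ (W W' : 𝒲) (p) (hW : p ∈ S W) (hW' : p ∈ S W'), φ W ⟨p, hW⟩ = φ W' ⟨p, hW'⟩ := by
    intro W W' p hW hW'
    obtain rfl : W = W' := by
      by_contra hne
      exact Set.disjoint_left.1 (hd W.2 W'.2 fun h => hne (Subtype.ext h)) hW hW'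
    rfl
  have hS : ∀ p, ∃ W, S W ∈ 𝓝 p := by
    intro p
    obtain ⟨W, hW, hp⟩ := p.2.2
    exact ⟨⟨W, hW⟩, ((h𝒲 W hW).1.preimage (by fun_prop :
      Continuous fun p : I × ↥(⋃₀ 𝒲) => p.2.1)).mem_nhds hp⟩
  have key : ∀ (p : I × ↥(⋃₀ 𝒲)) (W : 𝒲) (hp : p ∈ S W),
      ContinuousMap.liftCover S φ hφ hS p = H W (p.1, ⟨p.2.1, hp⟩) := fun p W hp =>
    ContinuousMap.liftCover_coe (S := S) (φ := φ) (hφ := hφ) (hS := hS) (i := W) ⟨p, hp⟩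
  refine ⟨⟨ContinuousMap.liftCover S φ hφ hS, fun x => ?_, fun x => ?_⟩⟩
  · obtain ⟨W, hW, hp⟩ := x.2
    have := key (0, x) ⟨W, hW⟩ hp
    simpa using this
  · obtain ⟨W, hW, hp⟩ := x.2
    have := key (1, x) ⟨W, hW⟩ hp
    simpa using this

/-- If an open map is injective on an open set whose inclusion is nullhomotopic, then the image of
that set is categorical. -/
theorem isCategorical_image {q : X → Y} (hq : Continuous q) (hqo : IsOpenMap q) {U : Set X}
    (hU : IsCategorical U) (hinj : InjOn q U) : IsCategorical (q '' U) := by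
  refine ⟨hqo U hU.1, ?_⟩
  have hemb : IsOpenEmbedding (U.domRestrict q) :=
    .of_continuous_injective_isOpenMap (hq.comp continuous_subtype_val)
      (injOn_iff_injective.1 hinj) (hqo.domRestrict hU.1)
  have hr : ∀ y : ↥(q '' U), y.1 ∈ Set.range (U.domRestrict q) := fun y => by
    rw [Set.range_domRestrict]; exact y.2
  let h := hemb.isEmbedding.toHomeomorph
  have h1 := (hU.2.comp_right ⟨q, hq⟩).comp_left
    ⟨fun y : ↥(q '' U) => h.symm ⟨y.1, hr y⟩, by fun_prop⟩
  convert h1 using 1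
  ext y
  exact (congrArg Subtype.val (h.apply_symm_apply ⟨y.1, hr y⟩)).symm

/-- Let `f i` be finitely many functions to `[0, 1]` on a path-connected space. If for every set `S`
of indices the locus where `f i > 0` for `i ∈ S` and `f i < 1` for `i ∉ S` is categorical, then
the category is at most the number of functions. -/
theorem lsCat_le_card {ι : Type*} [Fintype ι] (hX : ∀ x y : X, Joined x y) (f : ι → X → ℝ)
    (hf : ∀ i, Continuous (f i))
    (hcat : ∀ (_ : Nonempty X) (S : Finset ι), ∃ Z, IsCategorical Z ∧
      ∀ x, (∀ i ∈ S, 0 < f i x) → (∀ i ∉ S, f i x < 1) → x ∈ Z) :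
    lsCat X ≤ Fintype.card ι := by
  classical
  refine iInf₂_le (Fintype.card ι) ?_
  rcases isEmpty_or_nonempty X with hE | hne
  · exact ⟨∅, by simp, by simp [Set.eq_empty_of_isEmpty], by simp⟩
  -- The last condition puts every value indexed by `S` above every value indexed outside `S`. Two
  -- different index sets of equal size are incomparable, so they would require opposite strict
  -- inequalities at a common point.
  let W : Finset ι → Set X := fun S =>
    {x | (∀ i ∈ S, 0 < f i x) ∧ (∀ i ∉ S, f i x < 1) ∧ ∀ i ∈ S, ∀ j ∉ S, f j x < f i x}
  have hWo : ∀ S, IsOpen (W S) := by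
    intro S
    have : W S = (⋂ i ∈ S, {x | 0 < f i x}) ∩ ((⋂ i ∈ Sᶜ, {x | f i x < 1}) ∩
        ⋂ i ∈ S, ⋂ j ∈ Sᶜ, {x | f j x < f i x}) := by
      ext x; simp [W]
    rw [this]
    refine .inter ?_ (.inter ?_ ?_)
    · exact isOpen_biInter_finset fun i _ => isOpen_lt continuous_const (hf i)
    · exact isOpen_biInter_finset fun i _ => isOpen_lt (hf i) continuous_const
    · exact isOpen_biInter_finset fun i _ => isOpen_biInter_finset fun j _ =>
        isOpen_lt (hf j) (hf i)
  have hWc : ∀ S, IsCategorical (W S) := by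
    intro S
    obtain ⟨Z, hZ, hZS⟩ := hcat hne S
    exact hZ.mono (fun x hx => hZS x hx.1 hx.2.1) (hWo S)
  let U : Fin (Fintype.card ι + 1) → Set X := fun n => ⋃₀ {A | ∃ S : Finset ι, S.card = n ∧ A = W S}
  have hUc : ∀ n, IsCategorical (U n) := by
    intro n
    refine IsCategorical.sUnion hX ?_ ?_
    · rintro _ ⟨S, hS, rfl⟩ _ ⟨T, hT, rfl⟩ hne
      refine Set.disjoint_left.2 fun x hxS hxT => hne ?_
      have hST : S.card = T.card := hS.trans hT.symm
      by_cases h : S ⊆ T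
      · rw [Finset.eq_of_subset_of_card_le h hST.ge]
      · by_cases h' : T ⊆ S
        · rw [Finset.eq_of_subset_of_card_le h' hST.le]
        · obtain ⟨i, hi, hi'⟩ := Finset.not_subset.1 h
          obtain ⟨j, hj, hj'⟩ := Finset.not_subset.1 h'
          exact absurd (hxS.2.2 i hi j hj') (hxT.2.2 j hj i hi').not_gt
    · rintro _ ⟨S, -, rfl⟩
      exact hWc S
  refine ⟨Set.range U, ?_, ?_, ?_⟩
  · rw [← Set.image_univ]
    refine (Set.encard_image_le U univ).trans ?_
    simp [Set.encard_univ]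
  · refine Set.eq_univ_of_forall fun x => ?_
    -- A level `c` missed by the finitely many values splits the indices into those above and those
    -- below it; the former are the required `S`.
    obtain ⟨c, hc, hcx⟩ : ∃ c ∈ Ioo (0 : ℝ) 1, c ∉ Set.range fun i => f i x := by
      have := (Set.Ioo_infinite (zero_lt_one (α := ℝ))).sdiff (Set.finite_range fun i => f i x)
      exact this.nonempty
    let S : Finset ι := Finset.univ.filter fun i => c < f i x
    have hS : ∀ i ∉ S, f i x < c := by
      intro i hi
      simp only [S, Finset.mem_filter, Finset.mem_univ, true_and, not_lt] at hi
      exact lt_of_le_of_ne hi fun h => hcx ⟨i, h⟩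
    have hS' : ∀ i ∈ S, c < f i x := by simp [S]
    refine ⟨_, ⟨⟨S.card, Nat.lt_succ_of_le (Finset.card_le_univ S)⟩, rfl⟩, W S, ⟨S, rfl, rfl⟩, ?_⟩
    exact ⟨fun i hi => hc.1.trans (hS' i hi), fun i hi => (hS i hi).trans hc.2,
      fun i hi j hj => (hS j hj).trans (hS' i hi)⟩
  · rintro _ ⟨n, rfl⟩
    exact hUc n

end Categorical

/-! ### Configuration spaces -/

section Conf

variable {k : ℕ} {Y : Type*}

/-- Relabelling of an ordered configuration. -/
def OrderedConf.perm (x : OrderedConf k Y) (τ : Equiv.Perm (Fin k)) : OrderedConf k Y :=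
  ⟨x.1 ∘ τ, x.2.comp τ.injective⟩

/-- The unordered configuration underlying an ordered one. -/
def toUnordered (x : OrderedConf k Y) : UnorderedConf k Y := Quotient.mk _ x

theorem toUnordered_eq_iff {x y : OrderedConf k Y} :
    toUnordered x = toUnordered y ↔ ∃ τ, y = x.perm τ := by
  refine Quotient.eq.trans (exists_congr fun τ => ?_)
  exact ⟨fun h => Subtype.ext (funext h), fun h i => by rw [h]; rfl⟩

theorem toUnordered_perm (x : OrderedConf k Y) (τ : Equiv.Perm (Fin k)) :
    toUnordered (x.perm τ) = toUnordered x :=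
  (toUnordered_eq_iff.2 ⟨τ, rfl⟩).symm

variable [TopologicalSpace Y]

theorem continuous_toUnordered : Continuous (toUnordered : OrderedConf k Y → UnorderedConf k Y) :=
  continuous_quotient_mk'

theorem OrderedConf.continuous_perm (τ : Equiv.Perm (Fin k)) :
    Continuous fun x : OrderedConf k Y => x.perm τ := by
  unfold OrderedConf.perm
  refine Continuous.subtype_mk (continuous_pi fun i => ?_) _
  exact (continuous_apply (τ i)).comp continuous_subtype_val

theorem isOpenMap_toUnordered :
    IsOpenMap (toUnordered : OrderedConf k Y → UnorderedConf k Y) := by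
  intro U hU
  refine (isQuotientMap_quotient_mk' (s := confSetoid k Y)).isOpen_preimage.1 ?_
  have : (Quotient.mk (confSetoid k Y)) ⁻¹' (toUnordered '' U) =
      ⋃ τ : Equiv.Perm (Fin k), (fun x : OrderedConf k Y => x.perm τ) ⁻¹' U := by
    ext x
    simp only [mem_preimage, mem_image, mem_iUnion]
    constructor
    · rintro ⟨y, hy, h⟩
      obtain ⟨τ, rfl⟩ := toUnordered_eq_iff.1 h.symm
      exact ⟨τ, hy⟩
    · rintro ⟨τ, h⟩
      exact ⟨_, h, toUnordered_perm x τ⟩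
  exact this ▸ isOpen_iUnion fun τ => hU.preimage (OrderedConf.continuous_perm τ)

/-- Replacing one point of a configuration by a point outside it. -/
def OrderedConf.replace (x : OrderedConf k Y) (i : Fin k) (b : Y) (hb : ∀ l, l ≠ i → x.1 l ≠ b) :
    OrderedConf k Y :=
  ⟨Function.update x.1 i b, by
    intro l m h
    by_cases hl : l = i <;> by_cases hm : m = i
    · rw [hl, hm]
    · subst hl; rw [Function.update_self, Function.update_of_ne hm] at h
      exact absurd h.symm (hb m hm)
    · subst hm; rw [Function.update_self, Function.update_of_ne hl] at h
      exact absurd h (hb l hl)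
    · rw [Function.update_of_ne hl, Function.update_of_ne hm] at h
      exact x.2 h⟩

/-- Moving one point along a path which avoids the other points. -/
theorem joined_replace (x : OrderedConf k Y) (i : Fin k) {γ : ℝ → Y} (hγ : Continuous γ)
    {s t : ℝ} (hst : s ≤ t) (h : ∀ u ∈ Icc s t, ∀ l, l ≠ i → x.1 l ≠ γ u) (hs : x.1 i = γ s) :
    Joined x (x.replace i (γ t) (h t ⟨hst, le_rfl⟩)) := by
  have hu : ∀ r : I, s + r * (t - s) ∈ Icc s t := fun r =>
    ⟨by nlinarith [r.2.1], by nlinarith [r.2.2]⟩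
  refine ⟨⟨⟨fun r => x.replace i (γ (s + r * (t - s))) (h _ (hu r)), ?_⟩, ?_, ?_⟩⟩
  · unfold OrderedConf.replace
    exact Continuous.subtype_mk (continuous_const.update i (by fun_prop)) _
  · refine Subtype.ext ?_
    simp [OrderedConf.replace, ← hs]
  · refine Subtype.ext ?_
    simp [OrderedConf.replace]

/-- Labels do not matter, so points in the way act as a relay: the last point met before the target
moves to the target, and its old place becomes the new, nearer target for the `i`-th point. The
induction is on the number of other points on the path. -/
theorem joined_toUnordered_replace [T1Space Y] {γ : ℝ → Y} (hγ : Continuous γ) {s : ℝ} (n : ℕ) :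
    ∀ (t : ℝ) (_ : s ≤ t) (x : OrderedConf k Y) (i : Fin k) (_ : x.1 i = γ s)
      (hb : ∀ l, x.1 l ≠ γ t), {l | l ≠ i ∧ x.1 l ∈ γ '' Icc s t}.ncard ≤ n →
      Joined (toUnordered x) (toUnordered (x.replace i (γ t) fun l _ => hb l)) := by
  induction n using Nat.strong_induction_on with
  | _ n ih =>
  intro t hst x i hi hb hn
  -- the first time at which the target is reached
  obtain ⟨t', ⟨⟨ht's, ht't⟩, ht'⟩, hmin⟩ : ∃ t', IsLeast (Icc s t ∩ γ ⁻¹' {γ t}) t' :=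
    (isCompact_Icc.inter_right (isClosed_singleton.preimage hγ)).exists_isLeast
      ⟨t, ⟨hst, le_rfl⟩, rfl⟩
  -- the last time before that at which the path meets the configuration
  obtain ⟨u, ⟨⟨hsu, hut⟩, ⟨j, hj⟩⟩, hmax⟩ : ∃ u, IsGreatest (Icc s t' ∩ γ ⁻¹' Set.range x.1) u :=
    (isCompact_Icc.inter_right ((Set.finite_range x.1).isClosed.preimage hγ)).exists_isGreatest
      ⟨s, ⟨le_rfl, ht's⟩, ⟨i, hi⟩⟩
  have ht'' : γ t' = γ t := ht'
  have hfree : ∀ w ∈ Icc u t', ∀ l, l ≠ j → x.1 l ≠ γ w := by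
    intro w hw l hl hlw
    have h1 : w ≤ u := hmax ⟨⟨hsu.trans hw.1, hw.2⟩, ⟨l, hlw⟩⟩
    obtain rfl : w = u := le_antisymm h1 hw.1
    exact hl (x.2 (hlw.trans hj.symm))
  have hmove := (joined_replace x j hγ hut hfree hj).map continuous_toUnordered
  by_cases hij : j = i
  · subst hij
    have : x.replace j (γ t) (fun l _ => hb l) = x.replace j (γ t') (hfree t' ⟨hut, le_rfl⟩) :=
      Subtype.ext (by simp [OrderedConf.replace, ht''])
    rw [this]; exact hmove
  · set z := x.replace j (γ t') (hfree t' ⟨hut, le_rfl⟩) with hz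
    have hzj : z.1 j = γ t := by simp [hz, OrderedConf.replace, ht'']
    have hzl : ∀ l, l ≠ j → z.1 l = x.1 l := fun l hl => by
      simp [hz, OrderedConf.replace, Function.update_of_ne hl]
    have hult : u < t' := lt_of_le_of_ne hut fun h => hb j (by rw [hj, h, ht''])
    have hzb : ∀ l, z.1 l ≠ γ u := by
      intro l h
      by_cases hl : l = j
      · subst hl
        exact hb l (hj.trans (h.symm.trans hzj))
      · rw [hzl l hl, ← hj] at h
        exact hl (x.2 h)
    -- The point `j` was counted before; it now sits at `γ t`, which the path does not reach before
    -- `t' > u`.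
    have hlt : {l | l ≠ i ∧ z.1 l ∈ γ '' Icc s u}.ncard <
        {l | l ≠ i ∧ x.1 l ∈ γ '' Icc s t}.ncard := by
      refine Set.ncard_lt_ncard ⟨?_, fun hsub => ?_⟩ (Set.toFinite _)
      · rintro l ⟨hl, w, hw, hlw⟩
        have hlj : l ≠ j := by
          rintro rfl
          have : t' ≤ w := hmin ⟨⟨hw.1, (hw.2.trans hut).trans ht't⟩, hlw.trans hzj⟩
          linarith [hw.2]
        exact ⟨hl, w, ⟨hw.1, (hw.2.trans hut).trans ht't⟩, hlw.trans (hzl l hlj)⟩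
      · obtain ⟨-, w, hw, hlw⟩ := hsub (a := j) ⟨hij, u, ⟨hsu, hut.trans ht't⟩, hj.symm⟩
        have : t' ≤ w := hmin ⟨⟨hw.1, (hw.2.trans hut).trans ht't⟩, hlw.trans hzj⟩
        linarith [hw.2]
    have h2 := ih _ (hlt.trans_le hn) u hsu z i ((hzl i (Ne.symm hij)).trans hi) hzb le_rfl
    refine hmove.trans (h2.trans ?_)
    have hperm : z.replace i (γ u) (fun l _ => hzb l) =
        (x.replace i (γ t) fun l _ => hb l).perm (Equiv.swap i j) := by
      refine Subtype.ext (funext fun l => ?_)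
      simp only [OrderedConf.replace, OrderedConf.perm, Function.comp]
      by_cases hl : l = i
      · subst hl
        rw [Function.update_self, Equiv.swap_apply_left, Function.update_of_ne hij, hj]
      · rw [Function.update_of_ne hl]
        by_cases hlj : l = j
        · subst hlj
          rw [Equiv.swap_apply_right, Function.update_self, hzj]
        · rw [Equiv.swap_apply_of_ne_of_ne hl hlj, Function.update_of_ne hl, hzl l hlj]
    rw [hperm, toUnordered_perm]

/-- The unordered configuration spaces of a path-connected `T1` space are path-connected. -/
theorem joined_unorderedConf [T1Space Y] (hY : ∀ x y : Y, Joined x y) (x y : UnorderedConf k Y) :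
    Joined x y := by
  obtain ⟨y, rfl⟩ := Quotient.exists_rep y
  obtain ⟨x, rfl⟩ := Quotient.exists_rep x
  -- Each step moves a point outside the target configuration to an unoccupied place of it, lowering
  -- `n` by one.
  suffices H : ∀ (n : ℕ) (x : OrderedConf k Y), {i | x.1 i ∉ Set.range y.1}.ncard = n →
      Joined (toUnordered x) (toUnordered y) from H _ x rfl
  intro n
  induction n with
  | zero =>
    intro x hx
    rw [Set.ncard_eq_zero] at hx
    have hx' : ∀ i, ∃ j, y.1 j = x.1 i := fun i => by
      by_contra h
      have : i ∈ {i | x.1 i ∉ Set.range y.1} := h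
      rw [hx] at this
      exact this
    choose τ hτ using hx'
    have hτi : Function.Injective τ := fun i j h => x.2 (by rw [← hτ, ← hτ, h])
    have : x = y.perm (Equiv.ofBijective τ (Finite.injective_iff_bijective.1 hτi)) :=
      Subtype.ext (funext fun i => (hτ i).symm)
    rw [this, toUnordered_perm]
  | succ n ih =>
    intro x hx
    obtain ⟨i, hi⟩ : {i | x.1 i ∉ Set.range y.1}.Nonempty := by
      rw [← Set.ncard_pos]; omega
    obtain ⟨j, hj⟩ : ∃ j, ∀ l, x.1 l ≠ y.1 j := by
      by_contra! h
      choose τ hτ using h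
      have hτi : Function.Injective τ := fun a b h => y.2 (by rw [← hτ, ← hτ, h])
      obtain ⟨j, rfl⟩ := Finite.injective_iff_surjective.1 hτi i
      exact hi ⟨j, (hτ j).symm⟩
    obtain ⟨p⟩ := hY (x.1 i) (y.1 j)
    have hp1 : p.extend 1 = y.1 j := p.extend_one
    have hb : ∀ l, x.1 l ≠ p.extend 1 := fun l h => hj l (h.trans hp1)
    have h1 := joined_toUnordered_replace p.continuous_extend _ 1 zero_le_one x i
      p.extend_zero.symm hb le_rfl
    refine h1.trans (ih _ ?_)
    have : {l | (x.replace i (p.extend 1) fun l _ => hb l).1 l ∉ Set.range y.1} =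
        {i | x.1 i ∉ Set.range y.1} \ {i} := by
      ext l
      by_cases hl : l = i
      · subst hl
        simp [OrderedConf.replace]
      · simp [OrderedConf.replace, hl]
    rw [this, Set.ncard_sdiff_singleton_of_mem hi, hx]; rfl

end Conf

/-- A presentation of a space as a finite graph: finitely many edges are parametrized by the unit
interval, points outside a finite set `V` of vertices lie on exactly one edge at exactly one
parameter, and `V` is met by the edges only at their ends. Ends of edges need not lie in `V`. -/
structure GraphModel.{u} (Γ : Type u) [TopologicalSpace Γ] where
  /-- The vertices. -/
  V : Set Γ
  /-- The index type of the edges. -/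
  E : Type u
  /-- The parametrizations of the edges. -/
  γ : E → C(I, Γ)
  finite_V : V.Finite
  finite_E : Finite E
  surj : ∀ p ∉ V, ∃ e s, γ e s = p
  inj : ∀ {e e' s s'}, γ e s = γ e' s' → γ e s ∉ V → e = e' ∧ s = s'
  ends : ∀ {e s}, γ e s ∈ V → s = 0 ∨ s = 1

namespace GraphModel

universe u

variable {Γ : Type u} [TopologicalSpace Γ] (G : GraphModel Γ) {Y : Type*}

instance : Finite G.E := G.finite_E

/-! ### Functions on a graph -/

open Classical in
/-- The function with prescribed values at the vertices and along the edges. -/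
noncomputable def glue (w : Γ → Y) (g : G.E → I → Y) (p : Γ) : Y :=
  if h : p ∈ G.V then w p else g (G.surj p h).choose (G.surj p h).choose_spec.choose

variable {G}

theorem glue_of_mem (w : Γ → Y) (g : G.E → I → Y) {p : Γ} (hp : p ∈ G.V) : G.glue w g p = w p :=
  dif_pos hp

theorem glue_of_notMem (w : Γ → Y) (g : G.E → I → Y) {e : G.E} {s : I} (hp : G.γ e s ∉ G.V) :
    G.glue w g (G.γ e s) = g e s := by
  rw [glue, dif_neg hp]
  have h := (G.surj _ hp).choose_spec.choose_spec
  obtain ⟨h1, h2⟩ := G.inj h.symm hp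
  rw [← h2, ← h1]

theorem glue_edge {w : Γ → Y} {g : G.E → I → Y} (h0 : ∀ e, G.γ e 0 ∈ G.V → g e 0 = w (G.γ e 0))
    (h1 : ∀ e, G.γ e 1 ∈ G.V → g e 1 = w (G.γ e 1)) (e : G.E) (s : I) :
    G.glue w g (G.γ e s) = g e s := by
  by_cases hp : G.γ e s ∈ G.V
  · rw [glue_of_mem _ _ hp]
    rcases G.ends hp with rfl | rfl
    · exact (h0 e hp).symm
    · exact (h1 e hp).symm
  · exact glue_of_notMem _ _ hp

section Topology

variable [T2Space Γ] [TopologicalSpace Y]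

/-- The preimage of a closed set is a finite union of images of compact sets, one for each vertex
and each edge. The compact parameter space `T` allows homotopies to be treated. -/
theorem continuous_of_edges {T : Type*} [TopologicalSpace T] [CompactSpace T] [T2Space T]
    {F : T × Γ → Y} (hV : ∀ v ∈ G.V, Continuous fun t => F (t, v))
    (hE : ∀ e, Continuous fun q : T × I => F (q.1, G.γ e q.2)) : Continuous F := by
  refine continuous_iff_isClosed.2 fun C hC => ?_
  have h : F ⁻¹' C = (⋃ v ∈ G.V, (fun t : T => (t, v)) '' {t | F (t, v) ∈ C}) ∪
      ⋃ e, (fun q : T × I => (q.1, G.γ e q.2)) '' {q | F (q.1, G.γ e q.2) ∈ C} := by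
    ext ⟨t, p⟩
    constructor
    · intro hp
      by_cases hpV : p ∈ G.V
      · exact .inl (mem_biUnion hpV ⟨t, hp, rfl⟩)
      · obtain ⟨e, s, rfl⟩ := G.surj p hpV
        exact .inr (mem_iUnion.2 ⟨e, (t, s), hp, rfl⟩)
    · rintro (hp | hp)
      · obtain ⟨v, hv, t', ht', h⟩ := mem_iUnion₂.1 hp
        exact (show (t', v) = (t, p) from h) ▸ ht'
      · obtain ⟨e, q, hq, h⟩ := mem_iUnion.1 hp
        exact (show (q.1, G.γ e q.2) = (t, p) from h) ▸ hq
  rw [h]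
  refine .union (G.finite_V.isClosed_biUnion fun v hv => ?_) (isClosed_iUnion_of_finite fun e => ?_)
  · exact ((hC.preimage (hV v hv)).isCompact.image (by fun_prop)).isClosed
  · exact ((hC.preimage (hE e)).isCompact.image (by fun_prop)).isClosed

theorem continuous_of_edges' {F : Γ → Y} (hE : ∀ e, Continuous fun s => F (G.γ e s)) :
    Continuous F := by
  have : Continuous fun q : Unit × Γ => F q.2 :=
    continuous_of_edges (G := G) (fun v _ => (continuous_const : Continuous fun _ => F v))
      fun e => (hE e).comp continuous_snd
  exact this.comp (by fun_prop : Continuous fun p : Γ => ((), p))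


theorem isClosed_range_edge (e : G.E) : IsClosed (Set.range (G.γ e)) :=
  (isCompact_range (G.γ e).continuous).isClosed

variable (G) in
theorem isClosed_V : IsClosed G.V := G.finite_V.isClosed

theorem joined (G : GraphModel Γ) [ConnectedSpace Γ] (p q : Γ) : Joined p q := by
  classical
  -- Edges are path-connected, so this two-valued function is constant along each of them, hence
  -- continuous, hence constant on the connected graph.
  have h : Continuous fun r : Γ => decide (Joined p r) := by
    refine continuous_of_edges' (G := G) fun e => ?_
    have : ∀ s, Joined p (G.γ e s) ↔ Joined p (G.γ e 0) := by
      intro s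
      have hs : Joined (G.γ e 0) (G.γ e s) :=
        ⟨⟨⟨fun t => G.γ e (Set.Icc.convexComb 0 s t), (G.γ e).continuous.comp
          (Continuous.subtype_mk (by fun_prop) _)⟩, by simp, by simp⟩⟩
      exact ⟨fun h => h.trans hs.symm, fun h => h.trans hs⟩
    simp only [this]
    exact continuous_const
  have := PreconnectedSpace.constant inferInstance h (x := q) (y := p)
  simpa [Joined.refl] using this

end Topology

/-! ### Edges -/

variable (G) in
/-- The part of an edge outside the set of vertices. -/
def arc (e : G.E) : Set Γ := Set.range (G.γ e) \ G.V

variable (G) in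
/-- The parameter of a point on its edge. -/
noncomputable def pos : Γ → I := G.glue (fun _ => 0) fun _ s => s

theorem pos_edge {e : G.E} {s : I} (h : G.γ e s ∉ G.V) : G.pos (G.γ e s) = s :=
  glue_of_notMem _ _ h

theorem edge_pos {e : G.E} {p : Γ} (hp : p ∈ G.arc e) : G.γ e (G.pos p) = p := by
  obtain ⟨⟨s, rfl⟩, h⟩ := hp
  rw [pos_edge h]

theorem arc_unique {e e' : G.E} {p : Γ} (hp : p ∈ G.arc e) (hp' : p ∈ G.arc e') : e = e' := by
  obtain ⟨⟨s, rfl⟩, h⟩ := hp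
  obtain ⟨⟨s', h'⟩, -⟩ := hp'
  exact (G.inj h'.symm h).1

theorem exists_mem_arc {p : Γ} (hp : p ∉ G.V) : ∃ e, p ∈ G.arc e := by
  obtain ⟨e, s, rfl⟩ := G.surj p hp
  exact ⟨e, ⟨s, rfl⟩, hp⟩

theorem isOpen_arc [T2Space Γ] (e : G.E) : IsOpen (G.arc e) := by
  have h : (G.arc e)ᶜ = G.V ∪ ⋃ e' : {e' // e' ≠ e}, Set.range (G.γ e'.1) := by
    ext p
    constructor
    · intro hp
      by_cases hpV : p ∈ G.V
      · exact .inl hpV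
      · obtain ⟨e', he'⟩ := exists_mem_arc hpV
        exact .inr (mem_iUnion.2 ⟨⟨e', fun h => hp (h ▸ he')⟩, he'.1⟩)
    · rintro (hp | hp) hpe
      · exact hpe.2 hp
      · obtain ⟨e', he'⟩ := mem_iUnion.1 hp
        exact e'.2 (arc_unique ⟨he', hpe.2⟩ hpe)
  rw [← isClosed_compl_iff, h]
  exact G.isClosed_V.union (isClosed_iUnion_of_finite fun e' => isClosed_range_edge _)

/-- On the arc, the preimage of a closed `K` is cut out by the compact set `G.γ e '' K`. -/
theorem continuousOn_pos [T2Space Γ] (e : G.E) : ContinuousOn G.pos (G.arc e) := by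
  refine continuousOn_iff_isClosed.2 fun K hK =>
    ⟨G.γ e '' K, (hK.isCompact.image (G.γ e).continuous).isClosed, ?_⟩
  ext p
  refine and_congr_left fun hp => ?_
  constructor
  · intro h
    exact ⟨_, h, edge_pos hp⟩
  · rintro ⟨s, hs, rfl⟩
    rwa [mem_preimage, pos_edge hp.2]

/-- Vertices occur only at the extreme parameters `0` and `1`, and a proper convex combination is
extreme only if both of its ends are. An end of the edge may itself lie outside `V`, so `s` and `s'`
need not be interior. -/
theorem convexComb_notMem_V {e : G.E} {s s' : I} (h : G.γ e s ∉ G.V) (h' : G.γ e s' ∉ G.V) (t : I) :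
    G.γ e (Set.Icc.convexComb s s' t) ∉ G.V := by
  have hs0 : (s : ℝ) = 0 ∨ 0 < (s : ℝ) := s.2.1.eq_or_lt'
  have hs1 : (s : ℝ) = 1 ∨ (s : ℝ) < 1 := s.2.2.eq_or_lt
  have hs0' : (s' : ℝ) = 0 ∨ 0 < (s' : ℝ) := s'.2.1.eq_or_lt'
  have hs1' : (s' : ℝ) = 1 ∨ (s' : ℝ) < 1 := s'.2.2.eq_or_lt
  have ht0 : (t : ℝ) = 0 ∨ 0 < (t : ℝ) := t.2.1.eq_or_lt'
  have ht1 : (t : ℝ) = 1 ∨ (t : ℝ) < 1 := t.2.2.eq_or_lt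
  have hs := s.2.1
  have hs' := s'.2.1
  have hsl := s.2.2
  have hsl' := s'.2.2
  intro hV
  rcases ht0 with ht0 | ht0
  · obtain rfl : t = 0 := Subtype.ext ht0
    rw [Set.Icc.convexComb_zero] at hV; exact h hV
  rcases ht1 with ht1 | ht1
  · obtain rfl : t = 1 := Subtype.ext ht1
    rw [Set.Icc.convexComb_one] at hV; exact h' hV
  rcases G.ends hV with h0 | h1
  · have h0r : (1 - (t : ℝ)) * s + t * s' = 0 := congrArg Subtype.val h0
    rcases hs0 with hs0 | hs0
    · rw [h0, ← show s = 0 from Subtype.ext hs0] at hV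
      exact h hV
    · nlinarith [mul_pos (sub_pos.2 ht1) hs0, mul_nonneg ht0.le hs']
  · have h1r : (1 - (t : ℝ)) * s + t * s' = 1 := congrArg Subtype.val h1
    rcases hs1 with hs1 | hs1
    · rw [h1, ← show s = 1 from Subtype.ext hs1] at hV
      exact h hV
    · nlinarith [mul_pos (sub_pos.2 ht1) (sub_pos.2 hs1), mul_nonneg ht0.le (sub_nonneg.2 hsl')]

/-! ### Stars of vertices -/

variable (G) in
open Classical in
/-- The distance to the vertex `v`, normalized to be `1` outside the star of `v`, which consists of
the thirds of the edges adjacent to `v`. -/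
noncomputable def starDist (v : Γ) : Γ → I :=
  G.glue (fun p => if p = v then 0 else 1) fun e s => projIcc 0 1 zero_le_one
    (min (if G.γ e 0 = v then 3 * (s : ℝ) else 1) (if G.γ e 1 = v then 3 * (1 - (s : ℝ)) else 1))

open Classical in
theorem starDist_edge (v : Γ) (e : G.E) (s : I) :
    G.starDist v (G.γ e s) = projIcc 0 1 zero_le_one
      (min (if G.γ e 0 = v then 3 * (s : ℝ) else 1)
        (if G.γ e 1 = v then 3 * (1 - (s : ℝ)) else 1)) := by
  refine glue_edge (fun e _ => ?_) (fun e _ => ?_) e s <;> split_ifs <;> norm_num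

theorem starDist_of_mem (v : Γ) {p : Γ} (hp : p ∈ G.V) [Decidable (p = v)] :
    G.starDist v p = if p = v then 0 else 1 := by
  rw [starDist, glue_of_mem _ _ hp]
  congr

theorem continuous_starDist [T2Space Γ] (v : Γ) : Continuous (G.starDist v) := by
  classical
  refine continuous_of_edges' (G := G) fun e => ?_
  simp only [starDist_edge]
  refine continuous_projIcc.comp (.min ?_ ?_) <;> split_ifs <;> fun_prop

theorem starDist_edge_lt_one {v : Γ} {e : G.E} {s : I} :
    G.starDist v (G.γ e s) < 1 ↔
      (G.γ e 0 = v ∧ (s : ℝ) < 1 / 3) ∨ (G.γ e 1 = v ∧ 2 / 3 < (s : ℝ)) := by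
  classical
  rw [starDist_edge]
  have : ∀ r : ℝ, projIcc (0 : ℝ) 1 zero_le_one r < 1 ↔ r < 1 := by
    intro r
    rw [← Subtype.coe_lt_coe, coe_projIcc]
    simp
  rw [this, min_lt_iff]
  split_ifs with h0 h1 h1 <;> simp [*] <;> constructor <;> intro h <;> first
    | linarith
    | (rcases h with h | h
       · left; linarith
       · right; linarith)

theorem starDist_eq_zero {v p : Γ} (hv : v ∈ G.V) : G.starDist v p = 0 ↔ p = v := by
  classical
  by_cases hp : p ∈ G.V
  · rw [starDist_of_mem v hp]
    split_ifs with h <;> simp [h]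
  · obtain ⟨e, s, rfl⟩ := G.surj p hp
    refine ⟨fun h => absurd ?_ hp, fun h => absurd (h ▸ hv) hp⟩
    rw [starDist_edge] at h
    have h' : min (if G.γ e 0 = v then 3 * (s : ℝ) else 1)
        (if G.γ e 1 = v then 3 * (1 - (s : ℝ)) else 1) ≤ 0 := by
      rwa [show (0 : I) = ⟨0, by simp⟩ from rfl, projIcc_eq_left zero_lt_one] at h
    have hs0 := s.2.1
    have hs1 := s.2.2
    rcases min_le_iff.1 h' with h | h
    · split_ifs at h with h0
      · rw [show s = 0 from Subtype.ext (by simp only [Icc.coe_zero]; linarith), h0]; exact hv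
      · linarith
    · split_ifs at h with h0
      · rw [show s = 1 from Subtype.ext (by simp only [Icc.coe_one]; linarith), h0]; exact hv
      · linarith

theorem eq_of_starDist_lt_one_of_mem {v p : Γ} (hp : p ∈ G.V) (h : G.starDist v p < 1) : p = v := by
  classical
  rw [starDist_of_mem v hp] at h
  by_contra hne
  simp [hne] at h

/-- Stars use only the outer thirds of edges, so a point is within reach of at most one end of its
edge. -/
theorem eq_of_starDist_lt_one {v w p : Γ} (hv : G.starDist v p < 1) (hw : G.starDist w p < 1) :
    v = w := by
  by_cases hp : p ∈ G.V
  · rw [← eq_of_starDist_lt_one_of_mem hp hv, ← eq_of_starDist_lt_one_of_mem hp hw]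
  · obtain ⟨e, s, rfl⟩ := G.surj p hp
    rw [starDist_edge_lt_one] at hv hw
    rcases hv with ⟨hv, h⟩ | ⟨hv, h⟩ <;> rcases hw with ⟨hw, h'⟩ | ⟨hw, h'⟩
    · exact hv.symm.trans hw
    · linarith
    · linarith
    · exact hv.symm.trans hw

/-- A map of the unit interval which collapses the outer thirds. -/
noncomputable def collapse (s : I) : I := projIcc 0 1 zero_le_one (3 * (s : ℝ) - 1)

theorem continuous_collapse : Continuous collapse := by
  unfold collapse
  exact continuous_projIcc.comp (by fun_prop)

theorem collapse_eq_zero {s : I} (h : (s : ℝ) ≤ 1 / 3) : collapse s = 0 :=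
  projIcc_of_le_left _ (by linarith)

theorem collapse_eq_one {s : I} (h : 2 / 3 ≤ (s : ℝ)) : collapse s = 1 :=
  projIcc_of_right_le _ (by linarith)

variable (G) in
/-- A homotopy which contracts the stars of the vertices. -/
noncomputable def contract (q : I × Γ) : Γ :=
  G.glue (fun p => p) (fun e s => G.γ e (Set.Icc.convexComb s (collapse s) q.1)) q.2

theorem contract_edge (t : I) (e : G.E) (s : I) :
    G.contract (t, G.γ e s) = G.γ e (Set.Icc.convexComb s (collapse s) t) := by
  refine glue_edge (fun e _ => ?_) (fun e _ => ?_) e s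
  · rw [collapse_eq_zero (by norm_num), Set.Icc.convexComb_eq]
  · rw [collapse_eq_one (by norm_num), Set.Icc.convexComb_eq]

theorem contract_of_mem (t : I) {v : Γ} (hv : v ∈ G.V) : G.contract (t, v) = v :=
  glue_of_mem _ _ hv

theorem continuous_contract [T2Space Γ] : Continuous G.contract := by
  refine continuous_of_edges (G := G) (fun v hv => ?_) fun e => ?_
  · simp only [contract_of_mem _ hv]; exact continuous_const
  · simp only [contract_edge]
    refine (G.γ e).continuous.comp ?_
    have := continuous_collapse
    refine Continuous.subtype_mk ?_ _
    fun_prop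

theorem contract_zero (p : Γ) : G.contract (0, p) = p := by
  by_cases hp : p ∈ G.V
  · exact contract_of_mem _ hp
  · obtain ⟨e, s, rfl⟩ := G.surj p hp
    rw [contract_edge, Set.Icc.convexComb_zero]

theorem contract_one {v p : Γ} (h : G.starDist v p < 1) : G.contract (1, p) = v := by
  by_cases hp : p ∈ G.V
  · rw [contract_of_mem _ hp, eq_of_starDist_lt_one_of_mem hp h]
  · obtain ⟨e, s, rfl⟩ := G.surj p hp
    rw [contract_edge, Set.Icc.convexComb_one]
    rcases starDist_edge_lt_one.1 h with ⟨h, hs⟩ | ⟨h, hs⟩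
    · rw [collapse_eq_zero hs.le, h]
    · rw [collapse_eq_one hs.le, h]

/-- The contraction moves the parameter monotonically towards the nearer end. The term for the other
end is at least `1` at the starting point, even on a loop, so it does not affect the comparison. -/
theorem starDist_contract_le {v p : Γ} (h : G.starDist v p < 1) (t : I) :
    G.starDist v (G.contract (t, p)) ≤ G.starDist v p := by
  classical
  by_cases hp : p ∈ G.V
  · rw [contract_of_mem _ hp]
  · obtain ⟨e, s, rfl⟩ := G.surj p hp
    rw [contract_edge, starDist_edge, starDist_edge]
    refine monotone_projIcc _ ?_
    have ht0 := t.2.1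
    have ht1 := t.2.2
    have hs0 := s.2.1
    have hs1 := s.2.2
    rw [Set.Icc.coe_convexComb]
    rcases starDist_edge_lt_one.1 h with ⟨h, hs⟩ | ⟨h, hs⟩
    · rw [collapse_eq_zero hs.le]
      have h1 : (1 - (t : ℝ)) * s + t * (0 : I) ≤ s := by
        simp only [Icc.coe_zero]; nlinarith
      generalize (1 - (t : ℝ)) * s + t * (0 : I) = r at h1
      rw [if_pos h, if_pos h]
      refine le_min ((min_le_left _ _).trans (by linarith)) ((min_le_left _ _).trans ?_)
      split_ifs <;> linarith
    · rw [collapse_eq_one hs.le]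
      have h1 : (s : ℝ) ≤ (1 - (t : ℝ)) * s + t * (1 : I) := by
        simp only [Icc.coe_one]; nlinarith
      generalize (1 - (t : ℝ)) * s + t * (1 : I) = r at h1
      rw [if_pos h, if_pos h]
      refine le_min ((min_le_right _ _).trans ?_) ((min_le_right _ _).trans (by linarith))
      split_ifs <;> linarith

end GraphModel

namespace GraphModel

universe u

variable {Γ : Type u} [TopologicalSpace Γ] {G : GraphModel Γ} {k : ℕ} {O : Set Γ}
  {x y : OrderedConf k Γ}

/-! ### The combinatorial type of a configuration -/

variable (G) in
/-- The `i`-th point of the configuration lies in the star of `v` and is strictly closer to `v`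
than all other points. -/
def Near (x : OrderedConf k Γ) (v : Γ) (i : Fin k) : Prop :=
  G.starDist v (x.1 i) < 1 ∧ ∀ j, j ≠ i → G.starDist v (x.1 i) < G.starDist v (x.1 j)

variable (G) in
/-- The configurations in which every vertex in `O` has a strictly closest point in its star, and no
other vertex is occupied. -/
def nearSet (k : ℕ) (O : Set Γ) : Set (OrderedConf k Γ) :=
  {x | (∀ v ∈ O, ∃ i, G.Near x v i) ∧ ∀ v ∈ G.V \ O, ∀ i, x.1 i ≠ v}

variable (G) in
/-- The `i`-th point is not the closest point to a vertex in `O`, and it lies on the edge `e`. -/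
def OnEdge (O : Set Γ) (x : OrderedConf k Γ) (i : Fin k) (e : G.E) : Prop :=
  (∀ v ∈ O, ¬ G.Near x v i) ∧ x.1 i ∈ G.arc e

variable (G) in
/-- The `i`-th and the `j`-th point lie on the same edge in this order, and none of them is the
closest point to a vertex in `O`. -/
def Precedes (O : Set Γ) (x : OrderedConf k Γ) (i j : Fin k) : Prop :=
  (∃ e, G.OnEdge O x i e ∧ G.OnEdge O x j e) ∧ G.pos (x.1 i) < G.pos (x.1 j)

variable (G) in
/-- Two configurations have the same type if they have the same closest points to the vertices in
`O`, and the remaining points are distributed in the same order over the edges. -/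
def SameType (O : Set Γ) (x y : OrderedConf k Γ) : Prop :=
  (∀ v ∈ O, ∀ i, G.Near x v i ↔ G.Near y v i) ∧ (∀ i e, G.OnEdge O x i e ↔ G.OnEdge O y i e) ∧
    ∀ i j, G.Precedes O x i j ↔ G.Precedes O y i j

theorem SameType.refl (x : OrderedConf k Γ) : G.SameType O x x := by simp [SameType]

theorem SameType.symm (h : G.SameType O x y) : G.SameType O y x :=
  ⟨fun v hv i => (h.1 v hv i).symm, fun i e => (h.2.1 i e).symm, fun i j => (h.2.2 i j).symm⟩

theorem SameType.trans {z : OrderedConf k Γ} (h : G.SameType O x y) (h' : G.SameType O y z) :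
    G.SameType O x z :=
  ⟨fun v hv i => (h.1 v hv i).trans (h'.1 v hv i), fun i e => (h.2.1 i e).trans (h'.2.1 i e),
    fun i j => (h.2.2 i j).trans (h'.2.2 i j)⟩

theorem near_perm {v : Γ} {i : Fin k} (τ : Equiv.Perm (Fin k)) :
    G.Near (x.perm τ) v i ↔ G.Near x v (τ i) := by
  refine and_congr_right fun _ => ⟨fun h j hj => ?_, fun h j hj => h _ (τ.injective.ne hj)⟩
  simpa [OrderedConf.perm] using h (τ.symm j) fun h' => hj (by simp [← h'])

theorem onEdge_perm {i : Fin k} {e : G.E} (τ : Equiv.Perm (Fin k)) :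
    G.OnEdge O (x.perm τ) i e ↔ G.OnEdge O x (τ i) e := by
  simp only [OnEdge, near_perm]; rfl

theorem precedes_perm {i j : Fin k} (τ : Equiv.Perm (Fin k)) :
    G.Precedes O (x.perm τ) i j ↔ G.Precedes O x (τ i) (τ j) := by
  simp only [Precedes, onEdge_perm]; rfl

theorem perm_mem_nearSet (τ : Equiv.Perm (Fin k)) (hx : x ∈ G.nearSet k O) :
    x.perm τ ∈ G.nearSet k O := by
  refine ⟨fun v hv => ?_, fun v hv i => hx.2 v hv _⟩
  obtain ⟨i, hi⟩ := hx.1 v hv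
  exact ⟨τ.symm i, (near_perm τ).2 (by simpa using hi)⟩

theorem SameType.perm (h : G.SameType O x y) (τ : Equiv.Perm (Fin k)) :
    G.SameType O (x.perm τ) (y.perm τ) := by
  simp only [SameType, near_perm, onEdge_perm, precedes_perm]
  exact ⟨fun v hv i => h.1 v hv _, fun i e => h.2.1 _ e, fun i j => h.2.2 _ _⟩

theorem Near.unique {v : Γ} {i j : Fin k} (hi : G.Near x v i) (hj : G.Near x v j) : i = j := by
  by_contra h
  exact (hi.2 j (Ne.symm h)).not_gt (hj.2 i h)

/-- A point at a vertex of `O` has distance `0` there, so no other point can be strictly closer. -/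
theorem notMem_V_of_not_near (hx : x ∈ G.nearSet k O) {i : Fin k} (hi : ∀ v ∈ O, ¬ G.Near x v i) :
    x.1 i ∉ G.V := by
  intro hV
  by_cases hO : x.1 i ∈ O
  · obtain ⟨j, hj⟩ := hx.1 _ hO
    have hij : i ≠ j := fun h => hi _ hO (h ▸ hj)
    have := hj.2 i hij
    rw [(starDist_eq_zero hV).2 rfl] at this
    exact absurd this (not_lt.2 zero_le)
  · exact hx.2 _ ⟨hV, hO⟩ i rfl

theorem exists_onEdge (hx : x ∈ G.nearSet k O) {i : Fin k} (hi : ∀ v ∈ O, ¬ G.Near x v i) :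
    ∃ e, G.OnEdge O x i e := by
  obtain ⟨e, he⟩ := exists_mem_arc (notMem_V_of_not_near hx hi)
  exact ⟨e, hi, he⟩

theorem OnEdge.unique {i : Fin k} {e e' : G.E} (h : G.OnEdge O x i e) (h' : G.OnEdge O x i e') :
    e = e' :=
  arc_unique h.2 h'.2

theorem OnEdge.trichotomy {i j : Fin k} {e : G.E} (hi : G.OnEdge O x i e) (hj : G.OnEdge O x j e) :
    G.Precedes O x i j ∨ i = j ∨ G.Precedes O x j i := by
  rcases lt_trichotomy (G.pos (x.1 i)) (G.pos (x.1 j)) with h | h | h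
  · exact .inl ⟨⟨e, hi, hj⟩, h⟩
  · exact .inr (.inl (x.2 (by rw [← edge_pos hi.2, ← edge_pos hj.2, h])))
  · exact .inr (.inr ⟨⟨e, hj, hi⟩, h⟩)

theorem Precedes.trans {i j l : Fin k} (h : G.Precedes O x i j) (h' : G.Precedes O x j l) :
    G.Precedes O x i l := by
  obtain ⟨⟨e, hi, hj⟩, hlt⟩ := h
  obtain ⟨⟨e', hj', hl⟩, hlt'⟩ := h'
  obtain rfl := hj.unique hj'
  exact ⟨⟨e, hi, hl⟩, hlt.trans hlt'⟩

theorem Precedes.irrefl {i : Fin k} (h : G.Precedes O x i i) : False := lt_irrefl _ h.2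

/-- Configurations which agree up to relabelling and have the same type are equal. -/
theorem perm_eq_self_of_sameType (hx : x ∈ G.nearSet k O) {τ : Equiv.Perm (Fin k)}
    (h : G.SameType O x (x.perm τ)) : x.perm τ = x := by
  suffices hτ : ∀ i, τ i = i from Subtype.ext (funext fun i => congrArg x.1 (hτ i))
  intro i
  by_cases hi : ∃ v ∈ O, G.Near x v i
  · obtain ⟨v, hv, hi⟩ := hi
    exact ((near_perm τ).1 ((h.1 v hv i).1 hi)).unique hi
  · push Not at hi
    obtain ⟨e, he⟩ := exists_onEdge hx hi
    have he' := (onEdge_perm τ).1 ((h.2.1 i e).1 he)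
    -- Since `τ` preserves a strict order and has finite order, moving `i` up or down would produce
    -- a cycle.
    have hp : ∀ {a b}, G.Precedes O x a b → G.Precedes O x (τ a) (τ b) := fun {a b} hab =>
      (precedes_perm τ).1 ((h.2.2 a b).1 hab)
    have hper : (τ ^ (orderOf τ - 1 + 1)) i = i := by
      rw [Nat.sub_add_cancel (orderOf_pos τ), pow_orderOf_eq_one]; rfl
    rcases he.trichotomy he' with hlt | heq | hlt
    · have : ∀ n : ℕ, G.Precedes O x i ((τ ^ (n + 1)) i) := by
        intro n
        induction n with
        | zero => simpa using hlt
        | succ n ih =>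
          rw [pow_succ', Equiv.Perm.mul_apply]
          exact hlt.trans (hp ih)
      exact (hper ▸ this (orderOf τ - 1)).irrefl.elim
    · exact heq.symm
    · have : ∀ n : ℕ, G.Precedes O x ((τ ^ (n + 1)) i) i := by
        intro n
        induction n with
        | zero => simpa using hlt
        | succ n ih =>
          rw [pow_succ', Equiv.Perm.mul_apply]
          exact (hp ih).trans hlt
      exact (hper ▸ this (orderOf τ - 1)).irrefl.elim

section Topology

variable [T2Space Γ]

theorem isOpen_near (v : Γ) (i : Fin k) : IsOpen {x : OrderedConf k Γ | G.Near x v i} := by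
  have hc : ∀ j, Continuous fun x : OrderedConf k Γ => G.starDist v (x.1 j) := fun j =>
    (continuous_starDist v).comp ((continuous_apply j).comp continuous_subtype_val)
  simp only [Near, ofPred_and, ofPred_forall]
  exact (isOpen_lt (hc i) continuous_const).inter
    (isOpen_iInter_of_finite fun j => isOpen_iInter_of_finite fun _ => isOpen_lt (hc i) (hc j))

theorem isOpen_nearSet (hO : O ⊆ G.V) : IsOpen (G.nearSet k O) := by
  have h : G.nearSet k O = (⋂ v ∈ O, ⋃ i, {x | G.Near x v i}) ∩
      ⋂ v ∈ G.V \ O, ⋂ i, {x : OrderedConf k Γ | x.1 i ≠ v} := by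
    ext x; simp [nearSet]
  rw [h]
  refine .inter ((G.finite_V.subset hO).isOpen_biInter fun v _ => isOpen_iUnion fun i =>
    isOpen_near v i) (G.finite_V.sdiff.isOpen_biInter fun v _ => isOpen_iInter_of_finite fun i => ?_)
  exact isOpen_ne_fun ((continuous_apply i).comp continuous_subtype_val) continuous_const

/-- The type of a configuration is locally constant on `nearSet`. -/
theorem isOpen_sameType (hO : O ⊆ G.V) (y : OrderedConf k Γ) :
    IsOpen {x | x ∈ G.nearSet k O ∧ G.SameType O y x} := by
  refine isOpen_iff_mem_nhds.2 fun z ⟨hz, hyz⟩ => ?_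
  have hcont : ∀ i, Continuous fun x : OrderedConf k Γ => x.1 i := fun i =>
    (continuous_apply i).comp continuous_subtype_val
  have ha : ∀ᶠ x in 𝓝 z, ∀ v ∈ O, ∀ i, G.Near z v i → G.Near x v i := by
    refine (Filter.eventually_all_finite (G.finite_V.subset hO)).2 fun v _ =>
      Filter.eventually_all.2 fun i => ?_
    by_cases h : G.Near z v i
    · filter_upwards [(isOpen_near v i).mem_nhds h] with x hx _ using hx
    · simp [h]
  have hb : ∀ᶠ x in 𝓝 z, ∀ i e, G.OnEdge O z i e → x.1 i ∈ G.arc e := by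
    refine Filter.eventually_all.2 fun i => Filter.eventually_all.2 fun e => ?_
    by_cases h : G.OnEdge O z i e
    · filter_upwards [((isOpen_arc e).preimage (hcont i)).mem_nhds h.2] with x hx _ using hx
    · simp [h]
  have hc : ∀ᶠ x in 𝓝 z, ∀ i j, G.Precedes O z i j → G.pos (x.1 i) < G.pos (x.1 j) := by
    refine Filter.eventually_all.2 fun i => Filter.eventually_all.2 fun j => ?_
    by_cases h : G.Precedes O z i j
    · obtain ⟨⟨e, hi, hj⟩, hlt⟩ := h
      have hp : ∀ l, G.OnEdge O z l e → ContinuousAt (fun x : OrderedConf k Γ => G.pos (x.1 l)) z :=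
        fun l hl => ContinuousAt.comp (f := fun x : OrderedConf k Γ => x.1 l)
          ((continuousOn_pos e).continuousAt ((isOpen_arc e).mem_nhds hl.2)) (hcont l).continuousAt
      filter_upwards [(hp i hi).eventually_lt (hp j hj) hlt] with x hx _ using hx
    · simp [h]
  -- The open conditions give only one implication each. The converses follow because closest points
  -- are unique, each remaining point lies on exactly one arc, and two points of an arc are
  -- comparable.
  filter_upwards [ha, hb, hc, (isOpen_nearSet hO).mem_nhds hz] with x ha hb hc hx
  refine ⟨hx, hyz.trans ?_⟩
  have hnear : ∀ v ∈ O, ∀ i, G.Near z v i ↔ G.Near x v i := by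
    refine fun v hv i => ⟨ha v hv i, fun h => ?_⟩
    obtain ⟨j, hj⟩ := hz.1 v hv
    rwa [h.unique (ha v hv j hj)]
  have hedge : ∀ i e, G.OnEdge O z i e ↔ G.OnEdge O x i e := by
    refine fun i e => ⟨fun h => ⟨fun v hv hn => h.1 v hv ((hnear v hv i).2 hn), hb i e h⟩,
      fun h => ?_⟩
    obtain ⟨e', he'⟩ := exists_onEdge hz (i := i) fun v hv hn => h.1 v hv ((hnear v hv i).1 hn)
    rwa [arc_unique h.2 (hb i e' he')]
  refine ⟨hnear, hedge, fun i j => ⟨fun h => ⟨?_, hc i j h⟩, fun h => ?_⟩⟩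
  · obtain ⟨e, hi, hj⟩ := h.1
    exact ⟨e, (hedge i e).1 hi, (hedge j e).1 hj⟩
  · obtain ⟨e, hi, hj⟩ := h.1
    rcases ((hedge i e).2 hi).trichotomy ((hedge j e).2 hj) with h' | rfl | h'
    · exact h'
    · exact h.irrefl.elim
    · exact absurd h.2 (hc j i h').not_gt

/-! ### Contracting the configurations of one type -/

/-- Two successive homotopies in `F_k` lead to a configuration depending only on `y`: closest points
go to their vertices, and the remaining points are interpolated to their positions in `y`. -/
theorem isCategorical_sameType (hO : O ⊆ G.V) (hy : y ∈ G.nearSet k O) :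
    IsCategorical {x | x ∈ G.nearSet k O ∧ G.SameType O y x} := by
  classical
  refine ⟨isOpen_sameType hO y, ?_⟩
  set C : Set (OrderedConf k Γ) := {x | x ∈ G.nearSet k O ∧ G.SameType O y x} with hC
  have hcont : ∀ i, Continuous fun x : C => x.1.1 i := fun i =>
    (continuous_apply i).comp (continuous_subtype_val.comp continuous_subtype_val)
  let A : Fin k → Prop := fun i => ∃ v ∈ O, G.Near y v i
  have hA : ∀ (x : C) {i}, A i → ∃ v ∈ O, G.Near x.1 v i := fun x i ⟨v, hv, hi⟩ =>
    ⟨v, hv, (x.2.2.1 v hv i).1 hi⟩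
  -- move the closest points to the vertices
  let H₁ : I × C → Fin k → Γ := fun q i => if A i then G.contract (q.1, q.2.1.1 i) else q.2.1.1 i
  have hH₁c : Continuous H₁ := by
    refine continuous_pi fun i => ?_
    by_cases hi : A i
    · simp only [H₁, if_pos hi]
      exact continuous_contract.comp (continuous_fst.prodMk ((hcont i).comp continuous_snd))
    · simp only [H₁, if_neg hi]
      exact (hcont i).comp continuous_snd
  -- A moved point gets no farther from its vertex, while an unmoved point is strictly farther away;
  -- points moved to different vertices stay in disjoint stars.
  have hne : ∀ (q : I × C) (i j : Fin k), A i → i ≠ j → H₁ q i ≠ H₁ q j := by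
    rintro ⟨t, x⟩ i j hi hij h
    obtain ⟨v, hv, hiv⟩ := hA x hi
    simp only [H₁, if_pos hi] at h
    have h1 := starDist_contract_le hiv.1 t
    split_ifs at h with hj
    · obtain ⟨w, hw, hjw⟩ := hA x hj
      have h2 := starDist_contract_le hjw.1 t
      have h3 := eq_of_starDist_lt_one (h1.trans_lt hiv.1) (h ▸ h2.trans_lt hjw.1)
      exact hij (hiv.unique (h3 ▸ hjw))
    · rw [h] at h1
      exact h1.not_gt (hiv.2 j hij.symm)
  have hH₁i : ∀ q, Function.Injective (H₁ q) := by
    intro q i j h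
    by_contra hij
    by_cases hi : A i
    · exact hne q i j hi hij h
    by_cases hj : A j
    · exact hne q j i hj (Ne.symm hij) h.symm
    simp only [H₁, if_neg hi, if_neg hj] at h
    exact hij (q.2.1.2 h)
  let h₁ : C(I × C, OrderedConf k Γ) := ⟨fun q => ⟨H₁ q, hH₁i q⟩, hH₁c.subtype_mk _⟩
  -- rearrange the points on the edges
  have hg : ∀ i, ∃ g : C(I, Γ), ¬ A i → ∃ e, g = G.γ e ∧ G.OnEdge O y i e := by
    intro i
    by_cases hi : A i
    · exact ⟨.const _ (y.1 i), fun h => absurd hi h⟩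
    · obtain ⟨e, he⟩ := exists_onEdge hy (i := i) fun v hv h => hi ⟨v, hv, h⟩
      exact ⟨G.γ e, fun _ => ⟨e, rfl, he⟩⟩
  choose g hg using hg
  have hgx : ∀ {i}, ¬ A i → ∃ e, g i = G.γ e ∧ G.OnEdge O y i e ∧ ∀ x : C, G.OnEdge O x.1 i e := by
    intro i hi
    obtain ⟨e, he, hye⟩ := hg i hi
    exact ⟨e, he, hye, fun x => (x.2.2.2.1 i e).1 hye⟩
  let H₂ : I × C → Fin k → Γ := fun q i => if A i then G.contract (1, q.2.1.1 i) else
    g i (Set.Icc.convexComb (G.pos (q.2.1.1 i)) (G.pos (y.1 i)) q.1)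
  have hH₂c : Continuous H₂ := by
    refine continuous_pi fun i => ?_
    by_cases hi : A i
    · simp only [H₂, if_pos hi]
      exact continuous_contract.comp (continuous_const.prodMk ((hcont i).comp continuous_snd))
    · simp only [H₂, if_neg hi]
      obtain ⟨e, -, -, hx⟩ := hgx hi
      have hpos : Continuous fun x : C => G.pos (x.1.1 i) :=
        (continuousOn_pos e).comp_continuous (hcont i) fun x => (hx x).2
      have hpos' : Continuous fun q : I × C => (G.pos (q.2.1.1 i) : ℝ) :=
        continuous_subtype_val.comp (hpos.comp continuous_snd)
      refine (g i).continuous.comp (Continuous.subtype_mk ?_ _)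
      fun_prop
  have hH₂i : ∀ q, Function.Injective (H₂ q) := by
    rintro ⟨t, x⟩
    have hV : ∀ {i}, ¬ A i → H₂ (t, x) i ∉ G.V := by
      intro i hi
      obtain ⟨e, he, hye, hxe⟩ := hgx hi
      simp only [H₂, if_neg hi, he]
      refine convexComb_notMem_V ?_ ?_ t
      · rw [edge_pos (hxe x).2]; exact (hxe x).2.2
      · rw [edge_pos hye.2]; exact hye.2.2
    have hV' : ∀ {i}, A i → ∃ v ∈ O, G.Near x.1 v i ∧ H₂ (t, x) i = v := by
      intro i hi
      obtain ⟨v, hv, hiv⟩ := hA x hi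
      exact ⟨v, hv, hiv, by simp only [H₂, if_pos hi]; exact contract_one hiv.1⟩
    -- Interpolating between two pairs of parameters in the same strict order keeps them distinct.
    have hlt : ∀ {i j : Fin k}, ¬ A i → ¬ A j → G.Precedes O y i j →
        H₂ (t, x) i ≠ H₂ (t, x) j := by
      intro i j hi hj hij heq
      obtain ⟨e, he, hye, hxe⟩ := hgx hi
      obtain ⟨e', he', hye', hxe'⟩ := hgx hj
      have hVi := hV hi
      simp only [H₂, if_neg hi, if_neg hj, he, he'] at heq hVi
      have h1 := congrArg Subtype.val (G.inj heq hVi).2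
      simp only [Set.Icc.coe_convexComb] at h1
      have h2 : (G.pos (y.1 i) : ℝ) < G.pos (y.1 j) := hij.2
      have h3 : (G.pos (x.1.1 i) : ℝ) < G.pos (x.1.1 j) := ((x.2.2.2.2 i j).1 hij).2
      have ht0 := t.2.1
      have ht1 := t.2.2
      rcases ht0.eq_or_lt with h | h
      · rw [← h] at h1; linarith
      · nlinarith
    intro i j h
    by_contra hij
    by_cases hi : A i <;> by_cases hj : A j
    · obtain ⟨v, hv, hiv, hiv'⟩ := hV' hi
      obtain ⟨w, hw, hjw, hjw'⟩ := hV' hj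
      have : v = w := by rw [← hiv', ← hjw', h]
      exact hij (hiv.unique (this ▸ hjw))
    · obtain ⟨v, hv, hiv, hiv'⟩ := hV' hi
      exact hV hj (by rw [← h, hiv']; exact hO hv)
    · obtain ⟨v, hv, hiv, hiv'⟩ := hV' hj
      exact hV hi (by rw [h, hiv']; exact hO hv)
    · obtain ⟨e, he, hye, -⟩ := hgx hi
      obtain ⟨e', he', hye', -⟩ := hgx hj
      have hee : e = e' := by
        have hVi := hV hi
        simp only [H₂, if_neg hi, if_neg hj, he, he'] at h hVi
        exact (G.inj h hVi).1
      subst hee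
      rcases hye.trichotomy hye' with h' | h' | h'
      · exact hlt hi hj h' h
      · exact hij h'
      · exact hlt hj hi h' h.symm
  let h₂ : C(I × C, OrderedConf k Γ) := ⟨fun q => ⟨H₂ q, hH₂i q⟩, hH₂c.subtype_mk _⟩
  let r : C(C, OrderedConf k Γ) := h₁.comp ⟨fun x => (1, x), by fun_prop⟩
  have hy' : y ∈ C := ⟨hy, SameType.refl y⟩
  refine ⟨h₂ (1, ⟨y, hy'⟩), ContinuousMap.Homotopic.trans (g := r) ⟨⟨h₁, fun x => ?_, fun x => rfl⟩⟩
    ⟨⟨h₂, fun x => ?_, fun x => ?_⟩⟩⟩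
  · refine Subtype.ext (funext fun i => ?_)
    change (if A i then G.contract (0, x.1.1 i) else x.1.1 i) = x.1.1 i
    simp [contract_zero]
  · refine Subtype.ext (funext fun i => ?_)
    change H₂ (0, x) i = H₁ (1, x) i
    simp only [H₂, H₁]
    split_ifs with hi
    · rfl
    · obtain ⟨e, he, -, hx⟩ := hgx hi
      rw [he, Set.Icc.convexComb_zero, edge_pos (hx x).2]
  · refine Subtype.ext (funext fun i => ?_)
    change H₂ (1, x) i = H₂ (1, ⟨y, hy'⟩) i
    simp only [H₂]
    split_ifs with hi
    · obtain ⟨v, hv, hiv⟩ := hi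
      rw [contract_one hiv.1, contract_one ((x.2.2.1 v hv i).1 hiv).1]
    · simp

theorem isCategorical_nearSet [ConnectedSpace Γ] [Nonempty (UnorderedConf k Γ)] (hO : O ⊆ G.V) :
    IsCategorical (toUnordered '' G.nearSet k O) := by
  let 𝒲 : Set (Set (UnorderedConf k Γ)) :=
    {W | ∃ y ∈ G.nearSet k O, W = toUnordered '' {x | x ∈ G.nearSet k O ∧ G.SameType O y x}}
  have h : toUnordered '' G.nearSet k O = ⋃₀ 𝒲 := by
    ext z
    constructor
    · rintro ⟨x, hx, rfl⟩
      exact ⟨_, ⟨x, hx, rfl⟩, x, ⟨hx, SameType.refl x⟩, rfl⟩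
    · rintro ⟨_, ⟨y, hy, rfl⟩, x, hx, rfl⟩
      exact ⟨x, hx.1, rfl⟩
  -- Relabelling permutes the types, so images of two types in `B_k` that share a point coincide.
  have hsub : ∀ {y y' x : OrderedConf k Γ} (τ : Equiv.Perm (Fin k)), G.SameType O y x →
      G.SameType O y' (x.perm τ) → toUnordered '' {x | x ∈ G.nearSet k O ∧ G.SameType O y x} ⊆
        toUnordered '' {x | x ∈ G.nearSet k O ∧ G.SameType O y' x} := by
    rintro y y' x τ h h' _ ⟨z, ⟨hz, hyz⟩, rfl⟩
    exact ⟨z.perm τ, ⟨perm_mem_nearSet τ hz, h'.trans ((h.symm.trans hyz).perm τ)⟩,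
      toUnordered_perm z τ⟩
  rw [h]
  refine IsCategorical.sUnion (joined_unorderedConf G.joined) ?_ ?_
  · rintro _ ⟨y, hy, rfl⟩ _ ⟨y', hy', rfl⟩ hne
    refine Set.disjoint_left.2 ?_
    rintro _ ⟨x, ⟨hx, hyx⟩, rfl⟩ ⟨x', ⟨hx', hyx'⟩, heq⟩
    obtain ⟨τ, rfl⟩ := toUnordered_eq_iff.1 heq
    refine hne ((hsub τ.symm hyx ?_).antisymm (hsub τ hyx' hyx))
    convert hyx'
    exact Subtype.ext (funext fun i => by simp [OrderedConf.perm])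
  · rintro _ ⟨y, hy, rfl⟩
    refine isCategorical_image continuous_toUnordered isOpenMap_toUnordered
      (isCategorical_sameType hO hy) ?_
    rintro x ⟨hx, hyx⟩ x' ⟨hx', hyx'⟩ heq
    obtain ⟨τ, rfl⟩ := toUnordered_eq_iff.1 heq
    exact (perm_eq_self_of_sameType hx (hyx.symm.trans hyx')).symm

end Topology

/-! ### The ratio of the two smallest distances to a vertex -/

variable (G) in
/-- The smallest distance of a point of the configuration to `v`. -/
noncomputable def minDist (v : Γ) (x : OrderedConf k Γ) : I :=
  Finset.univ.inf fun i => G.starDist v (x.1 i)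

variable (G) in
/-- The second smallest distance of a point of the configuration to `v`. -/
noncomputable def minDist₂ (v : Γ) (x : OrderedConf k Γ) : I :=
  -- For `k ≤ 1` there are no pairs and the infimum is `⊤ = 1`.
  Finset.univ.offDiag.inf fun p => G.starDist v (x.1 p.1) ⊔ G.starDist v (x.1 p.2)

theorem minDist_perm (v : Γ) (x : OrderedConf k Γ) (τ : Equiv.Perm (Fin k)) :
    G.minDist v (x.perm τ) = G.minDist v x := by
  refine le_antisymm (Finset.le_inf fun i _ => ?_) (Finset.le_inf fun i _ => ?_)
  · refine (Finset.inf_le (Finset.mem_univ (τ.symm i))).trans ?_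
    simp [OrderedConf.perm]
  · exact Finset.inf_le (f := fun i => G.starDist v (x.1 i)) (Finset.mem_univ (τ i))

theorem minDist₂_perm (v : Γ) (x : OrderedConf k Γ) (τ : Equiv.Perm (Fin k)) :
    G.minDist₂ v (x.perm τ) = G.minDist₂ v x := by
  refine le_antisymm (Finset.le_inf fun p hp => ?_) (Finset.le_inf fun p hp => ?_)
  · refine (Finset.inf_le (b := (τ.symm p.1, τ.symm p.2)) (by simpa using hp)).trans ?_
    simp [OrderedConf.perm]
  · exact Finset.inf_le (f := fun p : Fin k × Fin k => G.starDist v (x.1 p.1) ⊔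
      G.starDist v (x.1 p.2)) (b := (τ p.1, τ p.2)) (by simpa using hp)

variable (G) in
/-- The ratio of the two smallest distances to `v`, on unordered configurations. -/
noncomputable def ratio (v : Γ) : UnorderedConf k Γ → ℝ :=
  Quotient.lift (fun x => (G.minDist v x : ℝ) / G.minDist₂ v x) fun x y h => by
    obtain ⟨τ, rfl⟩ := toUnordered_eq_iff.1 (Quotient.sound h)
    simp only [minDist_perm, minDist₂_perm]

theorem minDist₂_pos {v : Γ} (hv : v ∈ G.V) (x : OrderedConf k Γ) : 0 < G.minDist₂ v x := by
  refine (Finset.lt_inf_iff (by exact zero_lt_one)).2 fun p hp => ?_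
  rw [Finset.mem_offDiag] at hp
  rw [lt_sup_iff]
  by_contra! h
  have h1 := (starDist_eq_zero hv).1 (le_antisymm h.1 zero_le)
  have h2 := (starDist_eq_zero hv).1 (le_antisymm h.2 zero_le)
  exact hp.2.2 (x.2 (h1.trans h2.symm))

theorem continuous_ratio [T2Space Γ] {v : Γ} (hv : v ∈ G.V) :
    Continuous (G.ratio v : UnorderedConf k Γ → ℝ) := by
  refine Continuous.quotient_lift ?_ _
  have hc : ∀ j, Continuous fun x : OrderedConf k Γ => G.starDist v (x.1 j) := fun j =>
    (continuous_starDist v).comp ((continuous_apply j).comp continuous_subtype_val)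
  refine Continuous.div (continuous_subtype_val.comp ?_) (continuous_subtype_val.comp ?_) fun x =>
    (show (0 : ℝ) < G.minDist₂ v x from minDist₂_pos hv x).ne'
  · exact Continuous.finset_inf_apply fun i _ => hc i
  · exact Continuous.finset_inf_apply fun p _ => (hc p.1).sup (hc p.2)

/-- A gap between the two smallest distances makes the minimizer unique, and its distance is below
`minDist₂ ≤ 1`. -/
theorem exists_near_of_ratio_lt_one {v : Γ} (hv : v ∈ G.V) (h : G.ratio v (toUnordered x) < 1) :
    ∃ i, G.Near x v i := by
  have h' : G.minDist v x < G.minDist₂ v x :=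
    (div_lt_one (show (0 : ℝ) < G.minDist₂ v x from minDist₂_pos hv x)).1 h
  obtain ⟨i, -, hi⟩ := (Finset.inf_lt_iff).1 h'
  refine ⟨i, hi.trans_le le_one', fun j hj => ?_⟩
  have h2 : G.minDist₂ v x ≤ G.starDist v (x.1 i) ⊔ G.starDist v (x.1 j) :=
    Finset.inf_le (f := fun p : Fin k × Fin k => G.starDist v (x.1 p.1) ⊔ G.starDist v (x.1 p.2))
      (b := (i, j)) (by simpa using hj.symm)
  rcases lt_sup_iff.1 (hi.trans_le h2) with h3 | h3
  · exact absurd h3 (lt_irrefl _)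
  · exact h3

theorem ne_of_ratio_pos {v : Γ} (hv : v ∈ G.V) (h : 0 < G.ratio v (toUnordered x)) (i : Fin k) :
    x.1 i ≠ v := by
  intro hi
  have : G.minDist v x = 0 := le_antisymm
    ((Finset.inf_le (Finset.mem_univ i)).trans ((starDist_eq_zero hv).2 hi).le) zero_le
  have hpos : (0 : ℝ) < (G.minDist v x : ℝ) / G.minDist₂ v x := h
  simp [this] at hpos

/-- The category of the unordered configuration spaces of a connected graph is bounded by the number
of vertices of a model. -/
theorem lsCat_unorderedConf_le [T2Space Γ] [ConnectedSpace Γ] (G : GraphModel Γ) (k : ℕ) :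
    lsCat (UnorderedConf k Γ) ≤ G.V.encard := by
  classical
  have := G.finite_V.fintype
  rw [Set.encard_eq_coe_toFinset_card, Set.toFinset_card]
  refine lsCat_le_card (joined_unorderedConf G.joined) (fun v : G.V => G.ratio v.1)
    (fun v => continuous_ratio v.2) fun hne S => ?_
  -- Ratios below `1` are given off `S`, so `O` is the complement of `S` in `V`.
  let O : Set Γ := {v | ∃ h : v ∈ G.V, ⟨v, h⟩ ∉ S}
  refine ⟨toUnordered '' G.nearSet k O, isCategorical_nearSet fun v hv => hv.1, fun x h1 h0 => ?_⟩
  obtain ⟨x, rfl⟩ := Quotient.exists_rep x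
  refine ⟨x, ⟨fun v hv => exists_near_of_ratio_lt_one hv.1 (h0 ⟨v, hv.1⟩ hv.2), fun v hv i => ?_⟩,
    rfl⟩
  refine ne_of_ratio_pos hv.1 (h1 ⟨v, hv.1⟩ ?_) i
  by_contra h
  exact hv.2 ⟨hv.1, h⟩

end GraphModel

namespace GraphModel

universe u

variable {Γ : Type u} [TopologicalSpace Γ] {G : GraphModel Γ} {v : Γ}

/-! ### Half-edges -/

/-- Reversal of the unit interval, for `b = true`. -/
def flip (b : Bool) (s : I) : I := bif b then unitInterval.symm s else s

theorem continuous_flip (b : Bool) : Continuous (flip b) := by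
  cases b
  · exact continuous_id
  · exact continuous_symm

@[simp] theorem flip_flip (b : Bool) (s : I) : flip b (flip b s) = s := by
  cases b <;> simp [flip]

theorem flip_injective (b : Bool) : Function.Injective (flip b) :=
  Function.LeftInverse.injective (flip_flip b)

theorem flip_zero_or_one {b : Bool} {s : I} (h : flip b s = 0 ∨ flip b s = 1) :
    s = 0 ∨ s = 1 := by
  cases b
  · exact h
  · simpa [flip, or_comm] using h

variable (G) in
/-- The parametrization of the edge `h.1`, reversed if `h.2` is true. -/
def leg (h : G.E × Bool) : C(I, Γ) := (G.γ h.1).comp ⟨flip h.2, continuous_flip h.2⟩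

theorem leg_apply (h : G.E × Bool) (s : I) : G.leg h s = G.γ h.1 (flip h.2 s) := rfl

theorem edge_eq_leg (h : G.E × Bool) (s : I) : G.γ h.1 s = G.leg h (flip h.2 s) := by
  simp [leg_apply]

theorem leg_one (h : G.E × Bool) : G.leg h 1 = G.leg (h.1, !h.2) 0 := by
  obtain ⟨e, b⟩ := h
  cases b <;> simp [leg_apply, flip]

theorem leg_ends {h : G.E × Bool} {s : I} (hs : G.leg h s ∈ G.V) : s = 0 ∨ s = 1 :=
  flip_zero_or_one (G.ends hs)

theorem leg_injOn {h : G.E × Bool} {s s' : I} (hs : G.leg h s = G.leg h s') (hV : G.leg h s ∉ G.V) :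
    s = s' :=
  flip_injective _ (G.inj hs hV).2

variable (G) in
/-- The half-edges at a point. -/
def halfEdges (v : Γ) : Set (G.E × Bool) := {h | G.leg h 0 = v}

theorem exists_halfEdge (hv : v ∈ G.V) {e : G.E} {s : I} (h : G.γ e s = v) :
    ∃ b, (e, b) ∈ G.halfEdges v ∧ s = flip b 0 := by
  rcases G.ends (h ▸ hv) with rfl | rfl
  · exact ⟨false, h, rfl⟩
  · exact ⟨true, by simpa [halfEdges, leg_apply, flip] using h, by simp [flip]⟩

/-- No edge meets `v`, so all edges and the other vertices form a closed complement and `{v}` is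
clopen. -/
theorem subsingleton_of_halfEdges_eq_empty [T2Space Γ] [ConnectedSpace Γ] (hv : v ∈ G.V)
    (h : G.halfEdges v = ∅) : Subsingleton Γ := by
  have hne : ∀ e s, G.γ e s ≠ v := fun e s hs => by
    obtain ⟨b, hb, -⟩ := exists_halfEdge hv hs
    rw [h] at hb; exact hb
  have hc : ({v} : Set Γ)ᶜ = (G.V \ {v}) ∪ ⋃ e, Set.range (G.γ e) := by
    ext p
    constructor
    · intro hp
      by_cases hpV : p ∈ G.V
      · exact .inl ⟨hpV, hp⟩
      · obtain ⟨e, s, rfl⟩ := G.surj p hpV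
        exact .inr (mem_iUnion.2 ⟨e, s, rfl⟩)
    · rintro (hp | hp)
      · exact hp.2
      · obtain ⟨e, s, rfl⟩ := mem_iUnion.1 hp
        exact hne e s
  have ho : IsOpen ({v} : Set Γ) := by
    rw [← isClosed_compl_iff, hc]
    exact G.finite_V.sdiff.isClosed.union (isClosed_iUnion_of_finite fun e => isClosed_range_edge e)
  have huniv := IsClopen.eq_univ ⟨isClosed_singleton, ho⟩ (singleton_nonempty v)
  exact ⟨fun a b => (huniv ▸ mem_univ a : a ∈ ({v} : Set Γ)).trans
    (huniv ▸ mem_univ b : b ∈ ({v} : Set Γ)).symm⟩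

/-- A vertex at which exactly one edge ends once can be dropped. -/
theorem exists_model_of_halfEdges_eq_singleton (hv : v ∈ G.V) {h : G.E × Bool}
    (hh : G.halfEdges v = {h}) : ∃ G' : GraphModel Γ, G'.V = G.V \ {v} := by
  refine ⟨⟨G.V \ {v}, G.E, G.γ, G.finite_V.sdiff, G.finite_E, fun p hp => ?_, ?_,
    fun hs => G.ends hs.1⟩, rfl⟩
  · by_cases hpv : p = v
    · subst hpv
      have : h ∈ G.halfEdges p := hh ▸ rfl
      exact ⟨_, _, this⟩
    · exact G.surj p fun hpV => hp ⟨hpV, hpv⟩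
  · intro e e' s s' heq hs
    by_cases hV : G.γ e s ∈ G.V
    · have hsv : G.γ e s = v := by
        by_contra hne
        exact hs ⟨hV, hne⟩
      obtain ⟨b, hb, rfl⟩ := exists_halfEdge hv hsv
      obtain ⟨b', hb', rfl⟩ := exists_halfEdge hv (heq ▸ hsv)
      rw [hh] at hb hb'
      have := (show (e, b) = h from hb).trans (show (e', b') = h from hb').symm
      simp only [Prod.mk.injEq] at this
      exact ⟨this.1, by rw [this.2]⟩
    · exact G.inj heq hV

/-- If a vertex is the common end of a loop and of no other edge, then the graph is a circle. -/
theorem nonempty_homeomorph_circle [T2Space Γ] [ConnectedSpace Γ] (hv : v ∈ G.V) {e : G.E}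
    (hh : G.halfEdges v = {(e, false), (e, true)}) : Nonempty (Γ ≃ₜ Circle) := by
  have h0 : G.γ e 0 = v := by
    have : (e, false) ∈ G.halfEdges v := by rw [hh]; simp
    simpa [halfEdges, leg_apply, flip] using this
  have h1 : G.γ e 1 = v := by
    have : (e, true) ∈ G.halfEdges v := by rw [hh]; simp
    simpa [halfEdges, leg_apply, flip] using this
  have hV : ∀ s, G.γ e s ∈ G.V → G.γ e s = v := by
    intro s hs
    rcases G.ends hs with rfl | rfl
    exacts [h0, h1]
  -- Another edge could meet the loop only at `v`, where it has no half-edge. Hence the loop is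
  -- clopen and is the whole graph.
  have hc : (Set.range (G.γ e))ᶜ = (G.V \ {v}) ∪ ⋃ e' : {e' // e' ≠ e}, Set.range (G.γ e'.1) := by
    ext p
    constructor
    · intro hp
      by_cases hpV : p ∈ G.V
      · refine .inl ⟨hpV, fun hpv => hp ⟨0, ?_⟩⟩
        rw [h0]; exact hpv.symm
      · obtain ⟨e', s, rfl⟩ := G.surj p hpV
        exact .inr (mem_iUnion.2 ⟨⟨e', fun h => hp ⟨s, h ▸ rfl⟩⟩, s, rfl⟩)
    · rintro (hp | hp) ⟨s, rfl⟩
      · exact hp.2 (hV s hp.1)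
      · obtain ⟨e', s', hs'⟩ := mem_iUnion.1 hp
        by_cases hs : G.γ e s ∈ G.V
        · obtain ⟨b, hb, -⟩ := exists_halfEdge hv (hs'.trans (hV s hs))
          rw [hh] at hb
          rcases hb with hb | hb <;> exact e'.2 (congrArg Prod.fst hb)
        · exact e'.2 (G.inj hs'.symm hs).1.symm
  have hsurj : Set.range (G.γ e) = univ := by
    refine IsClopen.eq_univ ⟨isClosed_range_edge e, ?_⟩ ⟨_, 0, rfl⟩
    rw [← isClosed_compl_iff, hc]
    exact G.finite_V.sdiff.isClosed.union (isClosed_iUnion_of_finite fun e => isClosed_range_edge _)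
  have : Fact ((0 : ℝ) < 1) := ⟨zero_lt_one⟩
  let F : ℝ → Γ := fun r => G.γ e (projIcc 0 1 zero_le_one r)
  have hF : Continuous F := (G.γ e).continuous.comp continuous_projIcc
  let Φ : AddCircle (1 : ℝ) → Γ := AddCircle.liftIco 1 0 F
  have hΦ : Continuous Φ := by
    refine AddCircle.liftIco_continuous ?_ hF.continuousOn
    simp only [F, zero_add]
    rw [projIcc_right, projIcc_left]
    exact h0.trans h1.symm
  have hΦr : ∀ r ∈ Ico (0 : ℝ) 1, Φ (r : AddCircle (1 : ℝ)) = F r := fun r hr =>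
    AddCircle.liftIco_coe_apply (by simpa using hr)
  have hrep : ∀ z : AddCircle (1 : ℝ), ∃ r ∈ Ico (0 : ℝ) 1, (r : AddCircle (1 : ℝ)) = z := by
    intro z
    have : z ∈ ((↑) : ℝ → AddCircle (1 : ℝ)) '' Ico 0 (0 + 1) := by
      rw [AddCircle.coe_image_Ico_eq]; trivial
    simpa using this
  have hFs : ∀ r (hr : r ∈ Icc (0 : ℝ) 1), F r = G.γ e ⟨r, hr⟩ := fun r hr => by
    simp only [F, projIcc_of_mem zero_le_one hr]
  have hbij : Function.Bijective Φ := by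
    constructor
    · intro z z' h
      obtain ⟨r, hr, rfl⟩ := hrep z
      obtain ⟨r', hr', rfl⟩ := hrep z'
      rw [hΦr r hr, hΦr r' hr', hFs r ⟨hr.1, hr.2.le⟩, hFs r' ⟨hr'.1, hr'.2.le⟩] at h
      by_cases hs : G.γ e ⟨r, hr.1, hr.2.le⟩ ∈ G.V
      · have hzero : ∀ a (ha : a ∈ Ico (0 : ℝ) 1), G.γ e ⟨a, ha.1, ha.2.le⟩ ∈ G.V → a = 0 := by
          intro a ha haV
          rcases G.ends haV with h | h
          · exact congrArg Subtype.val h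
          · exact absurd (congrArg Subtype.val h) ha.2.ne
        rw [hzero r hr hs, hzero r' hr' (h ▸ hs)]
      · rw [show r = r' from congrArg Subtype.val (G.inj h hs).2]
    · intro p
      obtain ⟨s, rfl⟩ : p ∈ Set.range (G.γ e) := hsurj ▸ mem_univ p
      by_cases hs : s = 1
      · refine ⟨((0 : ℝ) : AddCircle (1 : ℝ)), ?_⟩
        rw [hΦr 0 (by simp), hFs 0 (by simp), hs, h1]
        exact h0
      · refine ⟨((s : ℝ) : AddCircle (1 : ℝ)), ?_⟩
        rw [hΦr s ⟨s.2.1, lt_of_le_of_ne s.2.2 fun h => hs (Subtype.ext h)⟩, hFs s s.2]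
  exact ⟨(Continuous.homeoOfEquivCompactToT2 (f := Equiv.ofBijective Φ hbij) hΦ).symm.trans
    (AddCircle.homeomorphCircle one_ne_zero)⟩

/-- Two edges which meet in a vertex that is not an end of another edge can be merged. -/
theorem exists_model_of_halfEdges_eq_pair (hv : v ∈ G.V) {h₁ h₂ : G.E × Bool}
    (hh : G.halfEdges v = {h₁, h₂}) (hne : h₁.1 ≠ h₂.1) :
    ∃ G' : GraphModel Γ, G'.V = G.V \ {v} := by
  classical
  have hmem : ∀ h, G.leg h 0 = v ↔ h = h₁ ∨ h = h₂ := fun h => Set.ext_iff.1 hh h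
  have hα0 : G.leg h₁ 0 = v := (hmem _).2 (.inl rfl)
  have hβ0 : G.leg h₂ 0 = v := (hmem _).2 (.inr rfl)
  -- The far end is the start of the reversed half-edge, which is neither `h₁` nor `h₂` because
  -- these lie on different edges.
  have hends : ∀ h, h = h₁ ∨ h = h₂ → ∀ s, G.leg h s = v → s = 0 := by
    intro h hor s hs
    rcases leg_ends (hs ▸ hv : G.leg h s ∈ G.V) with h0 | h1
    · exact h0
    · exfalso
      rw [h1, leg_one, hmem] at hs
      rcases hor with rfl | rfl <;> rcases hs with hs | hs
      · simpa using congrArg Prod.snd hs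
      · exact hne (congrArg Prod.fst hs :)
      · exact hne (congrArg Prod.fst hs :).symm
      · simpa using congrArg Prod.snd hs
  have hother : ∀ e, e ≠ h₁.1 → e ≠ h₂.1 → ∀ s, G.γ e s ≠ v := by
    intro e he₁ he₂ s hs
    obtain ⟨b, hb, -⟩ := exists_halfEdge hv hs
    rcases (hmem _).1 hb with h | h
    · exact he₁ (congrArg Prod.fst h)
    · exact he₂ (congrArg Prod.fst h)
  -- the merged edge
  let δ : I → Γ := fun s => if (s : ℝ) ≤ 1 / 2 then
      G.leg h₁ (projIcc 0 1 zero_le_one (1 - 2 * (s : ℝ)))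
    else G.leg h₂ (projIcc 0 1 zero_le_one (2 * (s : ℝ) - 1))
  have hδc : Continuous δ := by
    refine Continuous.if_le ?_ ?_ continuous_subtype_val continuous_const ?_
    · exact (G.leg h₁).continuous.comp (continuous_projIcc.comp (by fun_prop))
    · exact (G.leg h₂).continuous.comp (continuous_projIcc.comp (by fun_prop))
    · intro s hs
      rw [hs]
      norm_num
      exact hα0.trans hβ0.symm
  have hδ : ∀ s, ∃ (h : G.E × Bool) (a : I), δ s = G.leg h a ∧
      ((h = h₁ ∧ (s : ℝ) ≤ 1 / 2 ∧ (a : ℝ) = 1 - 2 * s) ∨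
        (h = h₂ ∧ 1 / 2 < (s : ℝ) ∧ (a : ℝ) = 2 * s - 1)) := by
    intro s
    by_cases hs : (s : ℝ) ≤ 1 / 2
    · refine ⟨h₁, _, if_pos hs, .inl ⟨rfl, hs, ?_⟩⟩
      rw [projIcc_of_mem zero_le_one ⟨by linarith, by linarith [s.2.1]⟩]
    · refine ⟨h₂, _, if_neg hs, .inr ⟨rfl, not_le.1 hs, ?_⟩⟩
      rw [projIcc_of_mem zero_le_one ⟨by linarith, by linarith [s.2.2]⟩]
  have hδ1 : ∀ a : I, ∃ s, δ s = G.leg h₁ a := fun a => by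
    refine ⟨⟨(1 - a) / 2, by linarith [a.2.2], by linarith [a.2.1]⟩, ?_⟩
    have ha := a.2.1
    simp only [δ]
    rw [if_pos (by linarith), show 1 - 2 * ((1 - (a : ℝ)) / 2) = a by ring, projIcc_val]
  have hδ2 : ∀ a : I, ∃ s, δ s = G.leg h₂ a := fun a => by
    by_cases ha0 : a = 0
    · obtain ⟨s, hs⟩ := hδ1 0
      exact ⟨s, by rw [hs, ha0, hα0, hβ0]⟩
    refine ⟨⟨(1 + a) / 2, by linarith [a.2.1], by linarith [a.2.2]⟩, ?_⟩
    have ha : (0 : ℝ) < a := lt_of_le_of_ne a.2.1 fun h => ha0 (Subtype.ext h.symm)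
    simp only [δ]
    rw [if_neg (by linarith), show 2 * ((1 + (a : ℝ)) / 2) - 1 = a by ring, projIcc_val]
  have hV : ∀ {p}, p ∉ G.V \ {v} → p ∈ G.V → p = v := fun hp hpV => by
    by_contra h
    exact hp ⟨hpV, h⟩
  have hmix : ∀ s e, e ≠ h₁.1 → e ≠ h₂.1 → ∀ s', δ s = G.γ e s' → δ s ∈ G.V \ {v} := by
    intro s e he₁ he₂ s' heq
    by_contra hs
    have hsV : δ s ∉ G.V := fun h => hother e he₁ he₂ s' (heq.symm.trans (hV hs h))
    obtain ⟨h, a, ha, hor⟩ := hδ s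
    rw [ha, leg_apply] at heq hsV
    have := (G.inj heq hsV).1
    rcases hor with ⟨rfl, -⟩ | ⟨rfl, -⟩
    · exact he₁ this.symm
    · exact he₂ this.symm
  let E' : Type u := Option {e : G.E // e ≠ h₁.1 ∧ e ≠ h₂.1}
  let γ' : E' → C(I, Γ) := fun o => Option.elim o ⟨δ, hδc⟩ fun e => G.γ e.1
  refine ⟨⟨G.V \ {v}, E', γ', G.finite_V.sdiff, inferInstanceAs (Finite (Option _)), ?_, ?_, ?_⟩,
    rfl⟩
  · intro p hp
    by_cases hpv : p = v
    · obtain ⟨s, hs⟩ := hδ1 0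
      exact ⟨none, s, by rw [hpv, ← hα0]; exact hs⟩
    · obtain ⟨e, s, rfl⟩ := G.surj p fun hpV => hpv (hV hp hpV)
      by_cases he₁ : e = h₁.1
      · subst he₁
        obtain ⟨s', hs'⟩ := hδ1 (flip h₁.2 s)
        exact ⟨none, s', by rw [edge_eq_leg]; exact hs'⟩
      by_cases he₂ : e = h₂.1
      · subst he₂
        obtain ⟨s', hs'⟩ := hδ2 (flip h₂.2 s)
        exact ⟨none, s', by rw [edge_eq_leg]; exact hs'⟩
      exact ⟨some ⟨e, he₁, he₂⟩, s, rfl⟩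
  · rintro (_ | e) (_ | e') s s' heq hs
    · refine ⟨rfl, ?_⟩
      change δ s = δ s' at heq
      change δ s ∉ _ at hs
      obtain ⟨h, a, ha, hor⟩ := hδ s
      obtain ⟨h', a', ha', hor'⟩ := hδ s'
      have hh' : h = h₁ ∨ h = h₂ := hor.imp And.left And.left
      have hh'' : h' = h₁ ∨ h' = h₂ := hor'.imp And.left And.left
      by_cases hsV : δ s ∈ G.V
      · have hsv := hV hs hsV
        have h0 : (a : ℝ) = 0 := congrArg Subtype.val (hends h hh' a (ha ▸ hsv))
        have h0' : (a' : ℝ) = 0 := congrArg Subtype.val (hends h' hh'' a' (ha' ▸ heq ▸ hsv))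
        refine Subtype.ext ?_
        rcases hor with ⟨-, -, h1⟩ | ⟨-, -, h1⟩ <;> rcases hor' with ⟨-, -, h2⟩ | ⟨-, -, h2⟩ <;>
          linarith
      · have heq' : G.leg h a = G.leg h' a' := by rw [← ha, ← ha', heq]
        rw [ha] at hsV
        have hfst := (G.inj heq' hsV).1
        rcases hor with ⟨rfl, -, h1⟩ | ⟨rfl, -, h1⟩ <;> rcases hor' with ⟨rfl, -, h2⟩ | ⟨rfl, -, h2⟩
        · have := congrArg Subtype.val (leg_injOn heq' hsV)
          exact Subtype.ext (by linarith)
        · exact absurd hfst hne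
        · exact absurd hfst.symm hne
        · have := congrArg Subtype.val (leg_injOn heq' hsV)
          exact Subtype.ext (by linarith)
    · exact absurd (hmix s e'.1 e'.2.1 e'.2.2 s' heq) hs
    · exact absurd (hmix s' e.1 e.2.1 e.2.2 s heq.symm) (by rw [← show _ = δ s' from heq]; exact hs)
    · change G.γ e.1 s = G.γ e'.1 s' at heq
      obtain ⟨h1, h2⟩ := G.inj heq fun hsV => hother e.1 e.2.1 e.2.2 s (hV hs hsV)
      exact ⟨congrArg some (Subtype.ext h1), h2⟩
  · rintro (_ | e) s hs
    · change δ s ∈ _ at hs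
      obtain ⟨h, a, ha, hor⟩ := hδ s
      rw [ha] at hs
      rcases leg_ends hs.1 with h0 | h1
      · refine absurd ?_ hs.2
        rw [h0]
        exact (hmem h).2 (hor.imp And.left And.left)
      · have h1' : (a : ℝ) = 1 := congrArg Subtype.val h1
        rcases hor with ⟨-, -, h1⟩ | ⟨-, -, h1⟩
        · exact .inl (Subtype.ext (by simp only [Icc.coe_zero]; linarith))
        · exact .inr (Subtype.ext (by simp only [Icc.coe_one]; linarith))
    · exact G.ends hs.1

/-- A connected graph which is neither a point nor a circle has a model in which at least three
edges end at every vertex. -/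
theorem exists_model_three_le [T2Space Γ] [ConnectedSpace Γ] [Nontrivial Γ]
    (hcircle : IsEmpty (Γ ≃ₜ Circle)) (G : GraphModel Γ) :
    ∃ G' : GraphModel Γ, G'.V ⊆ G.V ∧ ∀ v ∈ G'.V, 3 ≤ (G'.halfEdges v).ncard := by
  induction hn : G.V.ncard using Nat.strong_induction_on generalizing G with
  | _ n ih =>
  by_cases hG : ∀ v ∈ G.V, 3 ≤ (G.halfEdges v).ncard
  · exact ⟨G, subset_rfl, hG⟩
  push Not at hG
  obtain ⟨v, hv, hlt⟩ := hG
  obtain ⟨G₁, hG₁⟩ : ∃ G₁ : GraphModel Γ, G₁.V = G.V \ {v} := by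
    have hcases : (G.halfEdges v).ncard = 0 ∨ (G.halfEdges v).ncard = 1 ∨
        (G.halfEdges v).ncard = 2 := by omega
    rcases hcases with h | h | h
    · rw [Set.ncard_eq_zero] at h
      exact absurd (subsingleton_of_halfEdges_eq_empty hv h) (not_subsingleton Γ)
    · obtain ⟨a, ha⟩ := Set.ncard_eq_one.1 h
      exact exists_model_of_halfEdges_eq_singleton hv ha
    · obtain ⟨a, b, hab, h⟩ := Set.ncard_eq_two.1 h
      -- Two half-edges of the same edge form a loop, the case excluded by `hcircle`.
      by_cases hfst : a.1 = b.1
      · exfalso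
        obtain ⟨e, ba⟩ := a
        obtain ⟨e', bb⟩ := b
        obtain rfl : e = e' := hfst
        refine hcircle.elim (nonempty_homeomorph_circle hv (e := e) ?_).some
        rw [h]
        cases ba <;> cases bb <;> simp_all [Set.pair_comm]
      · exact exists_model_of_halfEdges_eq_pair hv h hfst
  have hlt' : G₁.V.ncard < n := by
    rw [hG₁, ← hn]
    exact Set.ncard_sdiff_singleton_lt_of_mem hv G.finite_V
  obtain ⟨G', hsub, h3⟩ := ih _ hlt' G₁ rfl
  exact ⟨G', hsub.trans (hG₁ ▸ sdiff_subset), h3⟩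

end GraphModel

namespace GraphModel

universe u

variable {Γ : Type u} [TopologicalSpace Γ] {G : GraphModel Γ} {v : Γ}

/-! ### Valence -/

variable (G) in
/-- The part of a half-edge with parameters in the open interval between `a` and `1 / 3`. -/
def branch (h : G.E × Bool) (a : ℝ) : Set Γ :=
  {p | p ∈ G.arc h.1 ∧ (flip h.2 (G.pos p) : ℝ) ∈ Ioo a (1 / 3)}

theorem isOpen_branch [T2Space Γ] (h : G.E × Bool) (a : ℝ) : IsOpen (G.branch h a) :=
  (continuousOn_pos h.1).isOpen_inter_preimage (isOpen_arc h.1)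
    (isOpen_Ioo.preimage (continuous_subtype_val.comp (continuous_flip h.2)))

theorem leg_notMem_V {h : G.E × Bool} {s : I} (h0 : 0 < (s : ℝ)) (h1 : (s : ℝ) < 1) :
    G.leg h s ∉ G.V := fun hV => by
  rcases leg_ends hV with rfl | rfl
  · exact lt_irrefl _ h0
  · exact lt_irrefl _ h1

theorem leg_mem_branch {h : G.E × Bool} {a : ℝ} (ha : 0 ≤ a) {s : I} (hs : (s : ℝ) ∈ Ioo a (1 / 3)) :
    G.leg h s ∈ G.branch h a := by
  have hV : G.leg h s ∉ G.V := leg_notMem_V (ha.trans_lt hs.1) (by linarith [hs.2])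
  refine ⟨⟨⟨_, rfl⟩, hV⟩, ?_⟩
  rw [leg_apply] at hV ⊢
  rwa [pos_edge hV, flip_flip]

theorem exists_of_mem_branch {h : G.E × Bool} {a : ℝ} {p : Γ} (hp : p ∈ G.branch h a) :
    ∃ s : I, (s : ℝ) ∈ Ioo a (1 / 3) ∧ G.leg h s = p :=
  ⟨_, hp.2, by rw [leg_apply, flip_flip, edge_pos hp.1]⟩

/-- The bound `1 / 3` separates the two half-edges of one edge, even of a loop. -/
theorem branch_unique {h h' : G.E × Bool} {p : Γ} (hp : p ∈ G.branch h 0) (hp' : p ∈ G.branch h' 0) :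
    h = h' := by
  obtain ⟨e, b⟩ := h
  obtain ⟨e', b'⟩ := h'
  obtain rfl : e = e' := arc_unique hp.1 hp'.1
  have h1 := hp.2.2
  have h2 := hp'.2.2
  cases b <;> cases b' <;> first
    | rfl
    | (simp only [flip, cond_true, cond_false, coe_symm_eq] at h1 h2; linarith)

theorem starDist_leg_lt_one {h : G.E × Bool} {s : I}
    (hlt : G.starDist v (G.leg h s) < 1) : (s : ℝ) < 1 / 3 ∨ 2 / 3 < (s : ℝ) := by
  obtain ⟨e, b⟩ := h
  rw [leg_apply, starDist_edge_lt_one] at hlt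
  cases b <;> simp only [flip, cond_true, cond_false, coe_symm_eq] at hlt <;>
    rcases hlt with ⟨-, h⟩ | ⟨-, h⟩ <;> first
    | (left; linarith)
    | (right; linarith)

theorem exists_branch_of_starDist_lt_one {p : Γ} (hp : G.starDist v p < 1)
    (hne : p ≠ v) : ∃ h ∈ G.halfEdges v, p ∈ G.branch h 0 := by
  have hpV : p ∉ G.V := fun h => hne (eq_of_starDist_lt_one_of_mem h hp)
  obtain ⟨e, s, rfl⟩ := G.surj p hpV
  have hs0 : s ≠ 0 ∨ G.γ e 0 ≠ v := by
    by_contra! h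
    exact hne (by rw [h.1, h.2])
  have hs1 : s ≠ 1 ∨ G.γ e 1 ≠ v := by
    by_contra! h
    exact hne (by rw [h.1, h.2])
  rcases starDist_edge_lt_one.1 hp with ⟨h0, hs⟩ | ⟨h1, hs⟩
  · refine ⟨(e, false), h0, leg_mem_branch (h := (e, false)) le_rfl ⟨?_, hs⟩⟩
    exact unitInterval.pos_iff_ne_zero.2 (hs0.resolve_right (not_not.2 h0))
  · refine ⟨(e, true), by simpa [halfEdges, leg_apply, flip] using h1, ?_⟩
    have hlt : (s : ℝ) < 1 := unitInterval.lt_one_iff_ne_one.2 (hs1.resolve_right (not_not.2 h1))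
    have := leg_mem_branch (G := G) (h := (e, true)) (s := unitInterval.symm s) le_rfl
      ⟨by rw [coe_symm_eq]; linarith, by rw [coe_symm_eq]; linarith⟩
    simpa [leg_apply, flip] using this

/-- A connected open neighbourhood of a vertex in its star meets every half-edge in an initial
segment. -/
theorem leg_mem_of_lt [T2Space Γ] (hv : v ∈ G.V) {U : Set Γ} (hUN : ∀ p ∈ U, G.starDist v p < 1)
    (hU : IsPreconnected U) (hvU : v ∈ U) {h : G.E × Bool} {s s' : I} (hs0 : 0 < (s' : ℝ))
    (hss : (s' : ℝ) < s) (hs : (s : ℝ) < 1 / 3) (hsU : G.leg h s ∈ U) : G.leg h s' ∈ U := by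
  by_contra hs'
  -- If `U` missed the point at `s'`, the disjoint open sets `G.branch h s'` and `Kᶜ` would separate
  -- `U`, with the point at `s` in the first and `v` in the second.
  let K : Set Γ := G.leg h '' {b : I | (s' : ℝ) ≤ b ∧ (b : ℝ) ≤ 1 / 3}
  have hK : IsClosed K := by
    refine (IsClosed.isCompact ?_ |>.image (G.leg h).continuous).isClosed
    exact (isClosed_le continuous_const continuous_subtype_val).inter
      (isClosed_le continuous_subtype_val continuous_const)
  have hcov : U ⊆ G.branch h s' ∪ Kᶜ := by
    intro p hp
    by_cases hpK : p ∈ K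
    · left
      obtain ⟨b, ⟨hb, hb'⟩, rfl⟩ := hpK
      refine leg_mem_branch hs0.le ⟨lt_of_le_of_ne hb fun heq => hs' ?_, ?_⟩
      · rwa [show s' = b from Subtype.ext heq]
      · rcases starDist_leg_lt_one (hUN _ hp) with h | h
        · exact h
        · linarith
    · exact .inr hpK
  have hvK : v ∉ K := by
    rintro ⟨b, ⟨hb, hb'⟩, hbv⟩
    exact leg_notMem_V (h := h) (s := b) (by linarith) (by linarith) (hbv ▸ hv)
  obtain ⟨p, -, hp, hpK⟩ := hU (G.branch h s') Kᶜ (isOpen_branch h _) hK.isOpen_compl hcov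
    ⟨_, hsU, leg_mem_branch hs0.le ⟨hss, hs⟩⟩ ⟨v, hvU, hvK⟩
  obtain ⟨b, hb, rfl⟩ := exists_of_mem_branch hp
  exact hpK ⟨b, ⟨hb.1.le, hb.2.le⟩, rfl⟩

/-- The valence of a vertex is the number of half-edges ending there. -/
theorem hasValence [T2Space Γ] (hv : v ∈ G.V) : HasValence v (G.halfEdges v).ncard := by
  refine ⟨{p | G.starDist v p < 1}, (isOpen_lt (continuous_starDist v) continuous_const).mem_nhds ?_,
    fun U hUN hUo hUc hvU => ?_⟩
  · rw [mem_ofPred_eq, (starDist_eq_zero hv).2 rfl]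
    exact zero_lt_one
  let W : Set Γ := U \ {v}
  have hW : ∀ p : W, ∃ h : G.halfEdges v, p.1 ∈ G.branch h.1 0 := fun p => by
    obtain ⟨h, hh, hp⟩ := exists_branch_of_starDist_lt_one (hUN p.2.1) p.2.2
    exact ⟨⟨h, hh⟩, hp⟩
  choose f hf using hW
  have hfib : ∀ (p : W) h, f p = h ↔ p.1 ∈ G.branch h.1 0 := fun p h =>
    ⟨fun heq => heq ▸ hf p, fun hp => Subtype.ext (branch_unique (hf p) hp)⟩
  let _ : TopologicalSpace (G.halfEdges v) := ⊥
  have _ : DiscreteTopology (G.halfEdges v) := ⟨rfl⟩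
  have hfc : Continuous f := by
    refine continuous_discrete_rng.2 fun h => ?_
    have : f ⁻¹' {h} = Subtype.val ⁻¹' G.branch h.1 0 := by
      ext p; exact hfib p h
    rw [this]
    exact (isOpen_branch h.1 0).preimage continuous_subtype_val
  have hLc : ∀ h, Continuous fun r : ℝ => G.leg h (projIcc 0 1 zero_le_one r) := fun h =>
    (G.leg h).continuous.comp continuous_projIcc
  have hpr : ∀ r : ℝ, r ∈ Ioo (0 : ℝ) (1 / 3) → (projIcc (0 : ℝ) 1 zero_le_one r : ℝ) = r :=
    fun r hr => by rw [projIcc_of_mem zero_le_one ⟨hr.1.le, by linarith [hr.2]⟩]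
  have hsurj : Function.Surjective f := by
    intro h
    have h1 : ∀ᶠ r in 𝓝[>] (0 : ℝ), G.leg h.1 (projIcc 0 1 zero_le_one r) ∈ U := by
      refine ((hLc h.1).continuousAt.eventually_mem (hUo.mem_nhds ?_)).filter_mono
        nhdsWithin_le_nhds
      rw [projIcc_left]
      have h0 : G.leg h.1 0 = v := h.2
      exact h0.symm ▸ hvU
    obtain ⟨r, hr, hr'⟩ := (h1.and (Ioo_mem_nhdsGT (by norm_num : (0 : ℝ) < 1 / 3))).exists
    have hb := leg_mem_branch (h := h.1) (a := 0) le_rfl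
      (s := projIcc 0 1 zero_le_one r) (by rw [hpr r hr']; exact hr')
    refine ⟨⟨_, hr, fun heq => hb.1.2 ?_⟩, (hfib _ _).2 hb⟩
    rw [show _ = v from heq]; exact hv
  have hpre : ∀ h, IsPreconnected (f ⁻¹' {h}) := by
    intro h
    rw [← IsInducing.subtypeVal.isPreconnected_image]
    have himg : Subtype.val '' (f ⁻¹' {h}) = (fun r : ℝ => G.leg h.1 (projIcc 0 1 zero_le_one r)) ''
        {r | r ∈ Ioo (0 : ℝ) (1 / 3) ∧ G.leg h.1 (projIcc 0 1 zero_le_one r) ∈ U} := by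
      ext p
      constructor
      · rintro ⟨q, hq, rfl⟩
        obtain ⟨s, hs, hsq⟩ := exists_of_mem_branch ((hfib q h).1 hq)
        refine ⟨s, ⟨hs, ?_⟩, ?_⟩
        · rw [projIcc_val, hsq]; exact q.2.1
        · simp only [projIcc_val, hsq]
      · rintro ⟨r, ⟨hr, hrU⟩, rfl⟩
        have hb := leg_mem_branch (h := h.1) (a := 0) le_rfl
          (s := projIcc 0 1 zero_le_one r) (by rw [hpr r hr]; exact hr)
        refine ⟨⟨_, hrU, fun heq => hb.1.2 ?_⟩, (hfib _ _).2 hb, rfl⟩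
        rw [show _ = v from heq]; exact hv
    rw [himg]
    refine IsPreconnected.image (OrdConnected.isPreconnected ⟨?_⟩) _ (hLc h.1).continuousOn
    rintro a ⟨ha, haU⟩ b ⟨hb, hbU⟩ c ⟨hac, hcb⟩
    have hc : c ∈ Ioo (0 : ℝ) (1 / 3) := ⟨ha.1.trans_le hac, hcb.trans_lt hb.2⟩
    refine ⟨hc, ?_⟩
    rcases hcb.eq_or_lt with rfl | hlt
    · exact hbU
    · refine leg_mem_of_lt hv (fun p hp => hUN hp) hUc.isPreconnected hvU
        (s := projIcc 0 1 zero_le_one b) ?_ ?_ ?_ hbU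
      · rw [hpr c hc]; exact hc.1
      · rw [hpr c hc, hpr b hb]; exact hlt
      · rw [hpr b hb]; exact hb.2
  -- The fibres of a continuous surjection onto a discrete space are the components once they are
  -- preconnected.
  have hbij : Function.Bijective hfc.connectedComponentsLift := by
    constructor
    · intro a b hab
      obtain ⟨p, rfl⟩ := ConnectedComponents.surjective_coe a
      obtain ⟨q, rfl⟩ := ConnectedComponents.surjective_coe b
      rw [hfc.connectedComponentsLift_apply_coe, hfc.connectedComponentsLift_apply_coe] at hab
      exact ConnectedComponents.coe_eq_coe'.2
        ((hpre (f q)).subset_connectedComponent rfl hab)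
    · intro h
      obtain ⟨p, rfl⟩ := hsurj h
      exact ⟨p, hfc.connectedComponentsLift_apply_coe p⟩
  rw [ENat.card_congr (Equiv.ofBijective _ hbij), ENat.card_eq_coe_natCard,
    Nat.card_coe_set_eq]

end GraphModel

-- Graph models from finite CW complexes of dimension at most one

universe u

/-- The affine parametrization of the closed unit ball of `Fin 1 → ℝ`. -/
def ballParam (s : I) : Fin 1 → ℝ := fun _ => 2 * (s : ℝ) - 1

theorem continuous_ballParam : Continuous ballParam := by
  unfold ballParam
  fun_prop

theorem norm_ballParam (s : I) : ‖ballParam s‖ = |2 * (s : ℝ) - 1| := by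
  simp [ballParam, Pi.norm_def]

theorem ballParam_mem_closedBall (s : I) : ballParam s ∈ Metric.closedBall 0 1 := by
  rw [mem_closedBall_zero_iff, norm_ballParam, abs_le]
  constructor <;> linarith [s.2.1, s.2.2]

theorem ballParam_mem_ball {s : I} (h : ¬ (s = 0 ∨ s = 1)) : ballParam s ∈ Metric.ball 0 1 := by
  push Not at h
  rw [mem_ball_zero_iff, norm_ballParam, abs_lt]
  have h0 : (0 : ℝ) < s := unitInterval.pos_iff_ne_zero.2 h.1
  have h1 : (s : ℝ) < 1 := unitInterval.lt_one_iff_ne_one.2 h.2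
  constructor <;> linarith

theorem ballParam_mem_sphere {s : I} (h : s = 0 ∨ s = 1) : ballParam s ∈ Metric.sphere 0 1 := by
  rw [mem_sphere_zero_iff_norm, norm_ballParam]
  rcases h with rfl | rfl <;> norm_num

theorem ballParam_injective : Function.Injective ballParam := by
  intro s s' h
  have := congrFun h 0
  simp only [ballParam] at this
  exact Subtype.ext (by linarith)

theorem exists_ballParam {x : Fin 1 → ℝ} (hx : x ∈ Metric.ball 0 1) : ∃ s, ballParam s = x := by
  have h : |x 0| < 1 := by
    rw [mem_ball_zero_iff] at hx
    exact (norm_le_pi_norm x 0).trans_lt hx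
  rw [abs_lt] at h
  refine ⟨⟨(x 0 + 1) / 2, by linarith, by linarith⟩, funext fun i => ?_⟩
  rw [Subsingleton.elim i 0]
  simp only [ballParam]
  ring

open Topology.RelCWComplex in
/-- The model given by the cells of a finite CW complex of dimension at most one. -/
theorem exists_model_of_cwComplex (Γ : Type u) [TopologicalSpace Γ]
    [Topology.CWComplex (Set.univ : Set Γ)] [Topology.RelCWComplex.Finite (Set.univ : Set Γ)]
    (hdim : ∀ n : ℕ, 1 < n → IsEmpty (cell (Set.univ : Set Γ) n)) :
    ∃ G : GraphModel Γ, G.V = {v | ∃ e : cell (Set.univ : Set Γ) 0, v ∈ openCell 0 e} := by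
  have hfin : ∀ n, _root_.Finite (cell (Set.univ : Set Γ) n) := fun n =>
    FiniteType.finite_cell n
  let V : Set Γ := {v | ∃ e : cell (Set.univ : Set Γ) 0, v ∈ openCell 0 e}
  have hV : V.Finite := by
    have : V = ⋃ e : cell (Set.univ : Set Γ) 0, openCell 0 e := by ext; simp [V]
    rw [this]
    refine Set.finite_iUnion fun e => ?_
    rw [openCell_zero_eq_singleton]
    exact Set.finite_singleton _
  let γ : cell (Set.univ : Set Γ) 1 → C(I, Γ) := fun e =>
    ⟨fun s => map 1 e (ballParam s), (continuousOn 1 e).comp_continuous continuous_ballParam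
      ballParam_mem_closedBall⟩
  have hopen : ∀ e s, ¬ (s = 0 ∨ s = 1) → γ e s ∈ openCell 1 e := fun e s hs =>
    ⟨_, ballParam_mem_ball hs, rfl⟩
  -- The boundary of a `1`-cell is mapped into closed cells of dimension below `1`, that is, into
  -- `0`-cells.
  have hends : ∀ e s, (s = 0 ∨ s = 1) → γ e s ∈ V := by
    intro e s hs
    obtain ⟨J, hJ⟩ := Topology.CWComplex.mapsTo (C := (Set.univ : Set Γ)) 1 e
    obtain ⟨m, hm, j, -, hj⟩ : ∃ m, ∃ _ : m < 1, ∃ j, ∃ _ : j ∈ J m,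
        γ e s ∈ map m j '' Metric.closedBall 0 1 := by
      have h := hJ (ballParam_mem_sphere hs)
      simp only [mem_iUnion] at h
      exact h
    obtain rfl : m = 0 := by omega
    refine ⟨j, ?_⟩
    have hj' : γ e s ∈ closedCell 0 j := hj
    rwa [closedCell_zero_eq_singleton, ← openCell_zero_eq_singleton] at hj'
  have hnotV : ∀ e s, ¬ (s = 0 ∨ s = 1) → γ e s ∉ V := by
    rintro e s hs ⟨e₀, he₀⟩
    refine Set.disjoint_left.1 (disjoint_openCell_of_ne (C := (Set.univ : Set Γ)) (n := 1) (m := 0)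
      (i := e) (j := e₀) ?_) (hopen e s hs) he₀
    intro h
    simpa using congrArg Sigma.fst h
  refine ⟨⟨V, cell (Set.univ : Set Γ) 1, γ, hV, hfin 1, ?_, ?_, ?_⟩, rfl⟩
  · intro p hp
    have hpu : p ∈ ⋃ (n : ℕ) (j : cell (Set.univ : Set Γ) n), openCell n j := by
      rw [Topology.CWComplex.iUnion_openCell_eq_complex]; trivial
    obtain ⟨n, j, hj⟩ := mem_iUnion₂.1 hpu
    match n, j, hj with
    | 0, j, hj => exact absurd ⟨j, hj⟩ hp
    | 1, j, hj =>
      obtain ⟨x, hx, rfl⟩ := hj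
      obtain ⟨s, rfl⟩ := exists_ballParam hx
      exact ⟨j, s, rfl⟩
    | n + 2, j, _ => exact ((hdim (n + 2) (by omega)).false j).elim
  · intro e e' s s' heq hs
    have hs1 : ¬ (s = 0 ∨ s = 1) := fun h => hs (hends e s h)
    have hs2 : ¬ (s' = 0 ∨ s' = 1) := fun h => hs (heq ▸ hends e' s' h)
    obtain rfl : e = e' := by
      by_contra hne
      refine Set.disjoint_left.1 (disjoint_openCell_of_ne (C := (Set.univ : Set Γ)) (n := 1)
        (m := 1) (i := e) (j := e') ?_) (hopen e s hs1) (heq ▸ hopen e' s' hs2)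
      intro h
      exact hne (by simpa using h)
    refine ⟨rfl, ballParam_injective ((map 1 e).injOn ?_ ?_ heq)⟩
    · rw [source_eq]; exact ballParam_mem_ball hs1
    · rw [source_eq]; exact ballParam_mem_ball hs2
  · intro e s hs
    by_contra h
    exact hnotV e s h hs

theorem lsCat_of_subsingleton (X : Type*) [TopologicalSpace X] [Subsingleton X] : lsCat X = 0 := by
  -- For empty `X` the cover must be empty, since a nullhomotopy needs a point of `X` as its
  -- constant value.
  refine le_antisymm (iInf₂_le (0 : ℕ) ⟨{U | U = univ ∧ Nonempty X}, ?_, ?_, ?_⟩) zero_le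
  · refine (Set.encard_le_encard (t := {univ}) fun U hU => hU.1).trans ?_
    simp
  · exact Set.eq_univ_of_forall fun x => ⟨univ, ⟨rfl, ⟨x⟩⟩, trivial⟩
  · rintro _ ⟨rfl, ⟨x⟩⟩
    exact ⟨isOpen_univ, x, by
      rw [show (⟨Subtype.val, continuous_subtype_val⟩ : C((univ : Set X), X)) = .const _ x from
        ContinuousMap.ext fun y => Subsingleton.elim _ _]⟩

end GraphConfig

/-! ### The bound by the number of essential vertices -/

theorem theorem3p9 (Γ : Type*) [TopologicalSpace Γ] [T2Space Γ]
    [Topology.CWComplex (Set.univ : Set Γ)]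
    [Topology.RelCWComplex.Finite (Set.univ : Set Γ)]
    (hdim : ∀ n : ℕ, 1 < n → IsEmpty (Topology.RelCWComplex.cell (Set.univ : Set Γ) n))
    [ConnectedSpace Γ] (hcircle : IsEmpty (Γ ≃ₜ Circle)) (k : ℕ) :
    GraphConfig.lsCat (GraphConfig.UnorderedConf k Γ) ≤
      (GraphConfig.essentialVertices Γ).encard := by
  rcases subsingleton_or_nontrivial Γ with hΓ | hΓ
  · have : Subsingleton (GraphConfig.UnorderedConf k Γ) := by
      refine ⟨fun x y => ?_⟩
      obtain ⟨x, rfl⟩ := Quotient.exists_rep x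
      obtain ⟨y, rfl⟩ := Quotient.exists_rep y
      rw [Subsingleton.elim x y]
    rw [GraphConfig.lsCat_of_subsingleton]
    exact zero_le
  · obtain ⟨G₀, hG₀⟩ := GraphConfig.exists_model_of_cwComplex Γ hdim
    obtain ⟨G, hG, h3⟩ := GraphConfig.GraphModel.exists_model_three_le hcircle G₀
    refine (G.lsCat_unorderedConf_le k).trans (Set.encard_le_encard fun v hv => ⟨?_, _, h3 v hv,
      GraphConfig.GraphModel.hasValence hv⟩)
    have := hG hv
    rwa [hG₀] at this
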